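/- Let $(\Omega,\mathcal A,\mu)$ be a measure space, with $\mu$ an arbitrary (not necessarily $\sigma$-finite) positive measure, and let $X$ be a real Banach space. A measurable set $A$ with $\mu(A)>0$ is an atom if every measurable $B\subseteq A$ satisfies $\mu(B)\in\{0,\mu(A)\}$. Let $\mathcal A_{a\sigma}$ be the system of countable unions of atoms and measurable sets of finite measure. An Orlicz function is an even, convex, lower semicontinuous $f\colon X\to[0,\infty]$ with $\lim_{x\to0}f(x)=0$ and $\lim_{\|x\|\to\infty}f(x)=\infty$. An Orlicz integrand is a map $\varphi\colon\Omega\times X\to[0,\infty]$ such that $\varphi(\omega,\cdot)$ is an Orlicz function for $\mu$-a.e. $\omega$, and such that for every $A\in\mathcal A_{a\sigma}$ and every separable $W\subseteq X$ the restriction of $\varphi$ to $A\times W$ is measurable for the product of the trace $\sigma$-algebra of $\mathcal A$ on $A$ and the Borel $\sigma$-algebra of $W$. For strongly measurable $u\colon\Omega\to X$ put $I_\varphi(u)=\sup_{A\in\mathcal A_{a\sigma}}\int_A\varphi(\omega,u(\omega))\,d\mu(\omega)$ and $\|u\|_\varphi=\inf\{\alpha>0: I_\varphi(\alpha^{-1}u)\le1\}$.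 Let $L_\varphi(\mu)$ be the space of a.e. equivalence classes of strongly measurable $u$ with $\|u\|_\varphi<\infty$ (that is, the set of admissible $\alpha$ is non-empty), normed by $\|\cdot\|_\varphi$, and let $L_\varphi(\mu)^*$ be its space of continuous linear functionals with the operator norm $\|\ell\|^*=\sup\{|\ell(u)|:\|u\|_\varphi\le1\}$. For $\ell\in L_\varphi(\mu)^*$ and $u\in L_\varphi(\mu)$ define the bounded, finitely additive set function $\nu_{\ell,u}(A)=\ell(u\chi_A)$, $A\in\mathcal A$. The functional $\ell$ is called - absolutely continuous if, for every $u\in L_\varphi(\mu)$, $\nu_{\ell,u}$ is a finite signed measure that is absolutely continuous with respect to $\mu$ and concentrated on a set that is $\sigma$-finite for $\mu$; - diffuse if, for every $u\in L_\varphi(\mu)$, $\nu_{\ell,u}$ is a finite signed measure whose variation vanishes on every measurable set of finite $\mu$-measure; - purely finitely additive if, for every $u\in L_\varphi(\mu)$, $\nu_{\ell,u}$ is purely finitely additive, i.e. the only (countably additive) measure dominated by its positive part, or by its negative part, is $0$, where the positive part of $\nu$ is $\nu^+(A)=\sup\{\nu(B): B\in\mathcal A,\ B\subseteq A\}$ and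 the negative part is $(-\nu)^+$. Theorem 6.5. The absolutely continuous, the diffuse and the purely finitely additive functionals form linear subspaces $A_{\varphi^*}(\mu)$, $D_{\varphi^*}(\mu)$, $F_{\varphi^*}(\mu)$ of $L_\varphi(\mu)^*$, and $$L_\varphi(\mu)^*=A_{\varphi^*}(\mu)\oplus D_{\varphi^*}(\mu)\oplus F_{\varphi^*}(\mu).$$ More explicitly, every $\ell\in L_\varphi(\mu)^*$ has a unique decomposition $\ell=\ell_a+\ell_d+\ell_f$ with $\ell_a\in A_{\varphi^*}(\mu)$, $\ell_d\in D_{\varphi^*}(\mu)$ and $\ell_f\in F_{\varphi^*}(\mu)$, and moreover $$\|\ell\|^*=\|\ell_a\|^*+\|\ell_d\|^*+\|\ell_f\|^*.$$ -/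

import Mathlib

open MeasureTheory Filter Topology
open scoped ENNReal NNReal

/-! ### Atoms, sigma-finite sets and the exhausting integral -/

/-- `A` is an atom of `μ`: a measurable set of positive measure such that every measurable subset
has measure `0` or `μ A`. -/
def IsMeasureAtom {Ω : Type*} [MeasurableSpace Ω] (μ : Measure Ω) (A : Set Ω) : Prop :=
  MeasurableSet A ∧ 0 < μ A ∧ ∀ B : Set Ω, MeasurableSet B → B ⊆ A → μ B = 0 ∨ μ B = μ A

/-- `A` is a countable union of measurable sets of finite measure. -/
def IsSigmaFiniteSet {Ω : Type*} [MeasurableSpace Ω] (μ : Measure Ω) (A : Set Ω) : Prop :=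
  ∃ B : ℕ → Set Ω, (∀ n, MeasurableSet (B n) ∧ μ (B n) < ∞) ∧ A = ⋃ n, B n

/-- `A` is a countable union of sets each of which is an atom or measurable of finite measure, i.e.
the union of countably many atoms and a sigma-finite set. -/
def IsAtomSigmaFiniteSet {Ω : Type*} [MeasurableSpace Ω] (μ : Measure Ω) (A : Set Ω) : Prop :=
  ∃ B : ℕ → Set Ω, (∀ n, IsMeasureAtom μ (B n) ∨ (MeasurableSet (B n) ∧ μ (B n) < ∞)) ∧
    A = ⋃ n, B n

/-- The exhausting integral of a nonnegative function: the supremum of its integrals over all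
countable unions of atoms and sets of finite measure. -/
noncomputable def exhaustingIntegral {Ω : Type*} [MeasurableSpace Ω] (μ : Measure Ω)
    (f : Ω → ℝ≥0∞) : ℝ≥0∞ :=
  ⨆ (A : Set Ω) (_ : IsAtomSigmaFiniteSet μ A), ∫⁻ ω in A, f ω ∂μ

/-! ### Orlicz functions and Orlicz integrands -/

/-- An Orlicz function on a real Banach space: even, convex, lower semicontinuous, with limit `0`
at the origin and limit `∞` at infinity. -/
structure IsOrliczFunction {X : Type*} [NormedAddCommGroup X] [NormedSpace ℝ X]
    (f : X → ℝ≥0∞) : Prop where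
  even : ∀ x, f (-x) = f x
  convex : ConvexOn ℝ≥0 Set.univ f
  lsc : LowerSemicontinuous f
  tendsto_zero : Tendsto f (𝓝 0) (𝓝 0)
  tendsto_top : Tendsto f (Bornology.cobounded X) (𝓝 ∞)

theorem IsOrliczFunction.map_zero {X : Type*} [NormedAddCommGroup X]
    [NormedSpace ℝ X] {f : X → ℝ≥0∞} (hf : IsOrliczFunction f) : f 0 = 0 :=
  tendsto_nhds_unique (tendsto_pure_nhds f 0 |>.mono_right le_rfl)
    (hf.tendsto_zero.mono_left (pure_le_nhds 0))

theorem IsOrliczFunction.map_smul_le {X : Type*} [NormedAddCommGroup X]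
    [NormedSpace ℝ X] {f : X → ℝ≥0∞} (hf : IsOrliczFunction f) (t : ℝ≥0)
    (ht : t ≤ 1) (x : X) : f ((t : ℝ) • x) ≤ t * f x := by
  have h := hf.convex.2 (Set.mem_univ x) (Set.mem_univ (0 : X)) zero_le zero_le
    (add_tsub_cancel_of_le ht)
  simpa [hf.map_zero, NNReal.smul_def, ENNReal.smul_def] using h

theorem IsOrliczFunction.map_smul_le_self {X : Type*} [NormedAddCommGroup X]
    [NormedSpace ℝ X] {f : X → ℝ≥0∞} (hf : IsOrliczFunction f) (t : ℝ)
    (ht : |t| ≤ 1) (x : X) : f (t • x) ≤ f x := by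
  have key : f (|t| • x) ≤ f x := by
    refine (hf.map_smul_le ⟨|t|, abs_nonneg t⟩ (by exact_mod_cast ht) x).trans ?_
    refine mul_le_of_le_one_left zero_le ?_
    exact ENNReal.coe_le_one_iff.2 (show (⟨|t|, abs_nonneg t⟩ : ℝ≥0) ≤ 1 from ht)
  rcases abs_choice t with h | h
  · rwa [h] at key
  · rw [h, neg_smul, hf.even] at key
    exact key

/-- An Orlicz integrand `φ : Ω × X → [0, ∞]`: almost every `φ ω` is an Orlicz function, and `φ` is
integrally separably measurable, i.e. its restriction to `A × W` is jointly measurable whenever `A`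
is a countable union of atoms and sets of finite measure and `W ⊆ X` is separable. -/
structure OrliczIntegrand {Ω : Type*} [MeasurableSpace Ω] (μ : Measure Ω)
    (X : Type*) [NormedAddCommGroup X] [NormedSpace ℝ X] [MeasurableSpace X] where
  toFun : Ω → X → ℝ≥0∞
  ae_isOrliczFunction : ∀ᵐ ω ∂μ, IsOrliczFunction (toFun ω)
  measurable_restrict : ∀ A : Set Ω, IsAtomSigmaFiniteSet μ A →
    ∀ W : Set X, TopologicalSpace.IsSeparable W → Measurable fun p : A × W => toFun p.1 p.2

/-! ### The Orlicz space with the Luxemburg norm -/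

section OrliczSpace

variable {Ω : Type*} [MeasurableSpace Ω] {μ : Measure Ω}
  {X : Type*} [NormedAddCommGroup X] [NormedSpace ℝ X] [MeasurableSpace X]

/-- The integral functional `u ↦ ∫ φ(ω, u(ω)) dμ(ω)`. -/
noncomputable def OrliczIntegrand.modular (φ : OrliczIntegrand μ X) (u : Ω → X) : ℝ≥0∞ :=
  exhaustingIntegral μ fun ω => φ.toFun ω (u ω)

/-- The set of admissible scalings in the Luxemburg norm. -/
def OrliczIntegrand.scalings (φ : OrliczIntegrand μ X) (u : Ω → X) : Set ℝ :=
  {α : ℝ | 0 < α ∧ φ.modular (fun ω => α⁻¹ • u ω) ≤ 1}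

/-- The Luxemburg norm `inf {α > 0 | I_φ(u / α) ≤ 1}`, the Minkowski functional of
`{I_φ ≤ 1}`. It is only used where the set of admissible `α` is nonempty. -/
noncomputable def OrliczIntegrand.luxemburg (φ : OrliczIntegrand μ X) (u : Ω → X) : ℝ :=
  sInf (φ.scalings u)

theorem IsAtomSigmaFiniteSet.measurableSet {A : Set Ω} (hA : IsAtomSigmaFiniteSet μ A) :
    MeasurableSet A := by
  obtain ⟨B, hB, rfl⟩ := hA
  exact MeasurableSet.iUnion fun n => (hB n).elim (fun h => h.1) (fun h => h.1)

theorem OrliczIntegrand.modular_mono (φ : OrliczIntegrand μ X) {u v : Ω → X}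
    (h : ∀ᵐ ω ∂μ, φ.toFun ω (u ω) ≤ φ.toFun ω (v ω)) : φ.modular u ≤ φ.modular v :=
  iSup₂_mono fun _ _ => lintegral_mono_ae (ae_restrict_of_ae h)

theorem OrliczIntegrand.modular_congr (φ : OrliczIntegrand μ X) {u v : Ω → X}
    (h : u =ᵐ[μ] v) : φ.modular u = φ.modular v :=
  le_antisymm (φ.modular_mono (h.mono fun ω hω => by rw [hω]))
    (φ.modular_mono (h.mono fun ω hω => by rw [hω]))

theorem OrliczIntegrand.scalings_congr (φ : OrliczIntegrand μ X) {u v : Ω → X}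
    (h : u =ᵐ[μ] v) : φ.scalings u = φ.scalings v := by
  ext α
  have e : φ.modular (fun ω => α⁻¹ • u ω) = φ.modular (fun ω => α⁻¹ • v ω) :=
    φ.modular_congr (h.mono fun ω hω => by simp only [hω])
  change (0 < α ∧ _ ≤ _) ↔ (0 < α ∧ _ ≤ _)
  rw [e]

theorem OrliczIntegrand.modular_zero (φ : OrliczIntegrand μ X) :
    φ.modular (fun _ => (0 : X)) = 0 := by
  refine le_antisymm (iSup₂_le fun A _ => ?_) zero_le
  rw [lintegral_congr_ae (ae_restrict_of_ae
    (φ.ae_isOrliczFunction.mono fun ω hω => hω.map_zero)), lintegral_zero]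

theorem OrliczIntegrand.aemeasurable_comp [BorelSpace X] (φ : OrliczIntegrand μ X) {u : Ω → X}
    (hu : AEStronglyMeasurable u μ) {A : Set Ω} (hA : IsAtomSigmaFiniteSet μ A) :
    AEMeasurable (fun ω => φ.toFun ω (u ω)) (μ.restrict A) := by
  have h1 : AEMeasurable (fun ω => φ.toFun ω (hu.mk u ω)) (μ.restrict A) := by
    refine (aemeasurable_restrict_iff_comap_subtype hA.measurableSet).2 (Measurable.aemeasurable ?_)
    have hm := φ.measurable_restrict A hA (Set.range (hu.mk u))
      hu.stronglyMeasurable_mk.isSeparable_range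
    have hg : Measurable fun ω : A => ((ω, ⟨hu.mk u ω, Set.mem_range_self _⟩) :
        A × Set.range (hu.mk u)) :=
      measurable_id.prodMk
        ((hu.stronglyMeasurable_mk.measurable.comp measurable_subtype_coe).subtype_mk)
    exact hm.comp hg
  refine h1.congr (ae_restrict_of_ae (hu.ae_eq_mk.mono fun ω hω => ?_))
  simp only [hω]

theorem OrliczIntegrand.modular_convex [BorelSpace X] (φ : OrliczIntegrand μ X) {u v : Ω → X}
    (hu : AEStronglyMeasurable u μ) {a b : ℝ≥0} (hab : a + b = 1) :
    φ.modular (fun ω => (a : ℝ) • u ω + (b : ℝ) • v ω) ≤ a * φ.modular u + b * φ.modular v := by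
  refine iSup₂_le fun A hA => ?_
  have h : ∫⁻ ω in A, φ.toFun ω ((a : ℝ) • u ω + (b : ℝ) • v ω) ∂μ ≤
      ∫⁻ ω in A, (a * φ.toFun ω (u ω) + b * φ.toFun ω (v ω)) ∂μ := by
    refine lintegral_mono_ae (ae_restrict_of_ae (φ.ae_isOrliczFunction.mono fun ω hω => ?_))
    have := hω.convex.2 (Set.mem_univ (u ω)) (Set.mem_univ (v ω)) zero_le zero_le hab
    simpa [NNReal.smul_def, ENNReal.smul_def] using this
  refine h.trans ?_
  rw [lintegral_add_left' ((φ.aemeasurable_comp hu hA).const_mul _),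
    lintegral_const_mul' _ _ ENNReal.coe_ne_top, lintegral_const_mul' _ _ ENNReal.coe_ne_top]
  gcongr
  · exact le_iSup₂ (f := fun (A : Set Ω) (_ : IsAtomSigmaFiniteSet μ A) =>
      ∫⁻ ω in A, φ.toFun ω (u ω) ∂μ) A hA
  · exact le_iSup₂ (f := fun (A : Set Ω) (_ : IsAtomSigmaFiniteSet μ A) =>
      ∫⁻ ω in A, φ.toFun ω (v ω) ∂μ) A hA

theorem OrliczIntegrand.scalings_bddBelow (φ : OrliczIntegrand μ X) (u : Ω → X) :
    BddBelow (φ.scalings u) := ⟨0, fun _ h => h.1.le⟩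

theorem OrliczIntegrand.scalings_add [BorelSpace X] (φ : OrliczIntegrand μ X) {u v : Ω → X}
    (hu : AEStronglyMeasurable u μ) {α β : ℝ} (hα : α ∈ φ.scalings u) (hβ : β ∈ φ.scalings v) :
    α + β ∈ φ.scalings (fun ω => u ω + v ω) := by
  obtain ⟨hα0, hα⟩ := hα
  obtain ⟨hβ0, hβ⟩ := hβ
  have hs : 0 < α + β := add_pos hα0 hβ0
  refine ⟨hs, ?_⟩
  obtain ⟨a, ha⟩ : ∃ a : ℝ≥0, (a : ℝ) = α / (α + β) := ⟨⟨_, by positivity⟩, rfl⟩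
  obtain ⟨b, hb⟩ : ∃ b : ℝ≥0, (b : ℝ) = β / (α + β) := ⟨⟨_, by positivity⟩, rfl⟩
  have hab : a + b = 1 := by
    apply NNReal.eq
    rw [NNReal.coe_add, ha, hb, NNReal.coe_one]
    field_simp
  have h := φ.modular_convex (u := fun ω => α⁻¹ • u ω) (v := fun ω => β⁻¹ • v ω)
    (hu.const_smul α⁻¹) hab
  have e : (fun ω => (a : ℝ) • (α⁻¹ • u ω) + (b : ℝ) • (β⁻¹ • v ω)) =
      fun ω => (α + β)⁻¹ • (u ω + v ω) := by
    funext ω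
    rw [ha, hb, smul_smul, smul_smul, smul_add]
    congr 2 <;> field_simp
  rw [e] at h
  refine h.trans ((add_le_add (mul_le_mul_right hα _) (mul_le_mul_right hβ _)).trans ?_)
  rw [mul_one, mul_one, ← ENNReal.coe_add, hab, ENNReal.coe_one]

theorem OrliczIntegrand.scalings_smul (φ : OrliczIntegrand μ X) {u : Ω → X} (c : ℝ) {α β : ℝ}
    (hα : α ∈ φ.scalings u) (hβ : 0 < β) (h : |c| * α ≤ β) :
    β ∈ φ.scalings (fun ω => c • u ω) := by
  refine ⟨hβ, le_trans (φ.modular_mono ?_) hα.2⟩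
  filter_upwards [φ.ae_isOrliczFunction] with ω hω
  have e : β⁻¹ • c • u ω = (β⁻¹ * c * α) • (α⁻¹ • u ω) := by
    rw [smul_smul, smul_smul]
    congr 1
    have := hα.1.ne'
    field_simp
  rw [e]
  apply hω.map_smul_le_self
  rw [abs_mul, abs_mul, abs_inv, abs_of_pos hβ, abs_of_pos hα.1, mul_assoc, inv_mul_le_iff₀ hβ]
  simpa using h

theorem exists_isAtomSigmaFiniteSet_subset {E : Set Ω} (hE : MeasurableSet E) (h0 : μ E ≠ 0) :
    ∃ A ⊆ E, IsAtomSigmaFiniteSet μ A ∧ μ A ≠ 0 := by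
  by_cases h : ∃ B ⊆ E, MeasurableSet B ∧ μ B ≠ 0 ∧ μ B < ∞
  · obtain ⟨B, hBE, hB, hB0, hBt⟩ := h
    exact ⟨B, hBE, ⟨fun _ => B, fun _ => Or.inr ⟨hB, hBt⟩, (Set.iUnion_const B).symm⟩, hB0⟩
  · push Not at h
    refine ⟨E, le_rfl, ⟨fun _ => E, fun _ => Or.inl ⟨hE, pos_iff_ne_zero.2 h0, ?_⟩, (Set.iUnion_const E).symm⟩, h0⟩
    intro B hB hBE
    by_cases hB0 : μ B = 0
    · exact Or.inl hB0
    · right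
      rw [top_le_iff.1 (h B hBE hB hB0), top_le_iff.1 (h E le_rfl hE h0)]

theorem OrliczIntegrand.ae_eq_zero_of_luxemburg_eq_zero [BorelSpace X] (φ : OrliczIntegrand μ X)
    {u : Ω → X} (hu : StronglyMeasurable u) (hne : (φ.scalings u).Nonempty)
    (h : φ.luxemburg u = 0) : u =ᵐ[μ] 0 := by
  -- every positive scaling is admissible
  have hall : ∀ β : ℝ, 0 < β → φ.modular (fun ω => β⁻¹ • u ω) ≤ 1 := by
    intro β hβ
    obtain ⟨α, hα, hlt⟩ := exists_lt_of_csInf_lt hne (show φ.luxemburg u < β by rw [h]; exact hβ)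
    have := φ.scalings_smul 1 hα hβ (by simpa using hlt.le)
    simpa using this.2
  have hzero : ∀ k : ℕ, φ.modular (fun ω => (k : ℝ) • u ω) = 0 := by
    intro k
    by_contra hk
    have hb : ∀ n : ℕ, (n + 1 : ℝ≥0∞) * φ.modular (fun ω => (k : ℝ) • u ω) ≤ 1 := by
      intro n
      have h1 : φ.modular (fun ω => (((n + 1) * (k + 1) : ℝ)⁻¹)⁻¹ • u ω) ≤ 1 :=
        hall _ (by positivity)
      have hab : ((n + 1 : ℝ≥0)⁻¹) + (1 - (n + 1 : ℝ≥0)⁻¹) = 1 :=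
        add_tsub_cancel_of_le (inv_le_one_of_one_le₀ (by simp))
      have h2 := φ.modular_convex (v := fun _ => (0 : X))
        (u := fun ω => (((n + 1) * (k + 1) : ℝ)) • u ω)
        (hu.const_smul _).aestronglyMeasurable (μ := μ) hab
      rw [φ.modular_zero, mul_zero, add_zero] at h2
      have h3 : φ.modular (fun ω => (k : ℝ) • u ω) ≤
          ((n + 1 : ℝ≥0)⁻¹ : ℝ≥0) * φ.modular (fun ω => ((n + 1) * (k + 1) : ℝ) • u ω) := by
        refine le_trans (φ.modular_mono ?_) h2
        filter_upwards [φ.ae_isOrliczFunction] with ω hω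
        have e : (k : ℝ) • u ω = ((k : ℝ) / (k + 1)) •
            ((((n + 1 : ℝ≥0)⁻¹ : ℝ≥0) : ℝ) • (((n + 1) * (k + 1) : ℝ) • u ω) +
              ((1 - (n + 1 : ℝ≥0)⁻¹ : ℝ≥0) : ℝ) • (0 : X)) := by
          rw [smul_zero, add_zero, smul_smul, smul_smul]
          congr 1
          push_cast
          field_simp
        rw [e]
        apply hω.map_smul_le_self
        rw [abs_of_nonneg (by positivity), div_le_one (by positivity)]
        linarith
      simp only [inv_inv] at h1
      have h4 := h3.trans (mul_le_mul_right h1 _)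
      calc (n + 1 : ℝ≥0∞) * φ.modular (fun ω => (k : ℝ) • u ω)
          ≤ (n + 1 : ℝ≥0∞) * (((n + 1 : ℝ≥0)⁻¹ : ℝ≥0) * 1) := mul_le_mul_right h4 _
        _ = (((n + 1 : ℝ≥0) * (n + 1 : ℝ≥0)⁻¹ : ℝ≥0) : ℝ≥0∞) := by push_cast; rw [mul_one]
        _ ≤ 1 := by rw [mul_inv_cancel₀ (by positivity)]; simp
    obtain ⟨n, hn⟩ := ENNReal.exists_nat_mul_gt hk ENNReal.one_ne_top
    exact absurd (hn.trans_le ((mul_le_mul_left (by simp) _).trans (hb n))) (lt_irrefl _)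
  by_contra hcon
  have hE : MeasurableSet {ω | u ω ≠ 0} := hu.measurable (measurableSet_singleton 0).compl
  have hE0 : μ {ω | u ω ≠ 0} ≠ 0 := fun h0 => hcon (by
    rw [EventuallyEq, ae_iff]; exact h0)
  obtain ⟨A, hAE, hA, hA0⟩ := exists_isAtomSigmaFiniteSet_subset hE hE0
  have hae : ∀ᵐ ω ∂(μ.restrict A), ∀ k : ℕ, φ.toFun ω ((k : ℝ) • u ω) = 0 := by
    rw [ae_all_iff]
    intro k
    have hi : ∫⁻ ω in A, φ.toFun ω ((k : ℝ) • u ω) ∂μ = 0 :=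
      le_antisymm ((le_iSup₂ (f := fun (A : Set Ω) (_ : IsAtomSigmaFiniteSet μ A) =>
        ∫⁻ ω in A, φ.toFun ω ((k : ℝ) • u ω) ∂μ) A hA).trans (hzero k).le) zero_le
    exact (lintegral_eq_zero_iff'
      (φ.aemeasurable_comp (hu.const_smul (k : ℝ)).aestronglyMeasurable hA)).1 hi
  have hfalse : ∀ᵐ ω ∂(μ.restrict A), False := by
    filter_upwards [hae, ae_restrict_of_ae φ.ae_isOrliczFunction,
      ae_restrict_mem hA.measurableSet] with ω h1 h2 h3
    have hne : u ω ≠ 0 := hAE h3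
    have ht : Tendsto (fun k : ℕ => (k : ℝ) • u ω) atTop (Bornology.cobounded X) := by
      rw [← tendsto_norm_atTop_iff_cobounded]
      simp only [norm_smul, Real.norm_natCast]
      exact tendsto_natCast_atTop_atTop.atTop_mul_const (norm_pos_iff.2 hne)
    have := h2.tendsto_top.comp ht
    have h4 : Tendsto (fun _ : ℕ => (0 : ℝ≥0∞)) atTop (𝓝 ∞) := this.congr fun k => h1 k
    exact ENNReal.zero_ne_top (tendsto_nhds_unique tendsto_const_nhds h4)
  have : μ.restrict A = 0 := by simpa [ae_eq_bot] using hfalse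
  exact hA0 (Measure.restrict_eq_zero.1 this)

variable [BorelSpace X]

/-- The Orlicz space: a.e. equivalence classes of strongly measurable functions `u : Ω → X` with
finite Luxemburg norm. -/
noncomputable def OrliczIntegrand.space (φ : OrliczIntegrand μ X) : Submodule ℝ (Ω →ₘ[μ] X) where
  carrier := {u | (φ.scalings u).Nonempty}
  zero_mem' := by
    refine ⟨1, one_pos, ?_⟩
    rw [φ.modular_congr (v := fun _ => (0 : X))
      ((AEEqFun.coeFn_zero (α := Ω) (β := X) (μ := μ)).mono fun ω hω => by simp [hω]),
      φ.modular_zero]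
    exact zero_le_one
  add_mem' := by
    rintro u v ⟨α, hα⟩ ⟨β, hβ⟩
    refine ⟨α + β, ?_⟩
    rw [φ.scalings_congr (AEEqFun.coeFn_add u v)]
    exact φ.scalings_add u.aestronglyMeasurable hα hβ
  smul_mem' := by
    rintro c u ⟨α, hα⟩
    refine ⟨|c| * α + 1, ?_⟩
    rw [φ.scalings_congr (AEEqFun.coeFn_smul c u)]
    exact φ.scalings_smul c hα
      (add_pos_of_nonneg_of_pos (mul_nonneg (abs_nonneg c) hα.1.le) one_pos) (by linarith)

/-- The Orlicz space carries the Luxemburg norm. -/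
noncomputable instance OrliczIntegrand.instNormSpace (φ : OrliczIntegrand μ X) : Norm φ.space where
  norm u := φ.luxemburg (u : Ω →ₘ[μ] X)

theorem OrliczIntegrand.norm_def (φ : OrliczIntegrand μ X) (u : φ.space) :
    ‖u‖ = sInf {α : ℝ | 0 < α ∧ φ.modular (fun ω => α⁻¹ • (u : Ω →ₘ[μ] X) ω) ≤ 1} := rfl

theorem OrliczIntegrand.norm_smul_le_aux (φ : OrliczIntegrand μ X) (c : ℝ) (u : φ.space) :
    ‖c • u‖ ≤ |c| * ‖u‖ := by
  refine le_of_forall_pos_le_add fun ε hε => ?_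
  have hc : (0 : ℝ) < |c| + 1 := by positivity
  obtain ⟨α, hα, hlt⟩ := exists_lt_of_csInf_lt u.2
    (show φ.luxemburg (u : Ω →ₘ[μ] X) < ‖u‖ + ε / (2 * (|c| + 1)) from
      lt_add_of_pos_right _ (by positivity))
  have hm : |c| * α + ε / 2 ∈ φ.scalings ((c • u : φ.space) : Ω →ₘ[μ] X) := by
    rw [Submodule.coe_smul, φ.scalings_congr (AEEqFun.coeFn_smul c (u : Ω →ₘ[μ] X))]
    have := mul_nonneg (abs_nonneg c) hα.1.le
    exact φ.scalings_smul c hα (by linarith) (by linarith)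
  refine (csInf_le (φ.scalings_bddBelow _) hm).trans ?_
  have h1 : |c| * α ≤ |c| * ‖u‖ + |c| * (ε / (2 * (|c| + 1))) := by
    rw [← mul_add]
    exact mul_le_mul_of_nonneg_left hlt.le (abs_nonneg c)
  have h2 : |c| * (ε / (2 * (|c| + 1))) ≤ ε / 2 := by
    rw [← mul_div_assoc, div_le_div_iff₀ (by positivity) (by positivity)]
    nlinarith
  linarith

theorem OrliczIntegrand.normCore (φ : OrliczIntegrand μ X) : NormedSpace.Core ℝ φ.space where
  norm_nonneg u := Real.sInf_nonneg fun _ h => h.1.le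
  norm_smul c u := by
    refine le_antisymm (φ.norm_smul_le_aux c u) ?_
    rcases eq_or_ne c 0 with rfl | hc
    · rw [norm_zero, zero_mul]
      exact Real.sInf_nonneg fun _ h => h.1.le
    · have h := φ.norm_smul_le_aux c⁻¹ (c • u)
      rw [inv_smul_smul₀ hc, abs_inv] at h
      rw [Real.norm_eq_abs]
      rwa [← le_inv_mul_iff₀ (abs_pos.2 hc)]
  norm_triangle u v := by
    refine le_of_forall_pos_le_add fun ε hε => ?_
    obtain ⟨α, hα, hα'⟩ := exists_lt_of_csInf_lt u.2
      (show φ.luxemburg (u : Ω →ₘ[μ] X) < ‖u‖ + ε / 2 from lt_add_of_pos_right _ (by positivity))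
    obtain ⟨β, hβ, hβ'⟩ := exists_lt_of_csInf_lt v.2
      (show φ.luxemburg (v : Ω →ₘ[μ] X) < ‖v‖ + ε / 2 from lt_add_of_pos_right _ (by positivity))
    have hm : α + β ∈ φ.scalings ((u + v : φ.space) : Ω →ₘ[μ] X) := by
      rw [Submodule.coe_add, φ.scalings_congr (AEEqFun.coeFn_add _ _)]
      exact φ.scalings_add (u : Ω →ₘ[μ] X).aestronglyMeasurable hα hβ
    have := csInf_le (φ.scalings_bddBelow _) hm
    change sInf _ ≤ _
    linarith
  norm_eq_zero_iff u := by
    constructor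
    · intro h
      have h0 := φ.ae_eq_zero_of_luxemburg_eq_zero (u : Ω →ₘ[μ] X).stronglyMeasurable u.2 h
      exact Subtype.ext (AEEqFun.ext (h0.trans AEEqFun.coeFn_zero.symm))
    · rintro rfl
      have h := φ.norm_smul_le_aux 0 0
      rw [zero_smul, abs_zero, zero_mul] at h
      exact le_antisymm h (Real.sInf_nonneg fun _ h => h.1.le)

noncomputable instance OrliczIntegrand.instNormedAddCommGroup (φ : OrliczIntegrand μ X) :
    NormedAddCommGroup φ.space :=
  NormedAddCommGroup.ofCore φ.normCore

noncomputable instance OrliczIntegrand.instNormedSpace (φ : OrliczIntegrand μ X) :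
    NormedSpace ℝ φ.space :=
  NormedSpace.ofCore φ.normCore

/-- The product `u χ_A` of an element of the Orlicz space with the indicator of a measurable set. -/
noncomputable def OrliczIntegrand.mulIndicator (φ : OrliczIntegrand μ X) (u : φ.space)
    (A : Set Ω) (hA : MeasurableSet A) : φ.space :=
  ⟨AEEqFun.mk (A.indicator (u : Ω →ₘ[μ] X))
      ((u : Ω →ₘ[μ] X).aestronglyMeasurable.indicator hA), by
    obtain ⟨α, hα⟩ := u.2
    refine ⟨α, ?_⟩
    rw [φ.scalings_congr (AEEqFun.coeFn_mk _ _)]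
    refine ⟨hα.1, le_trans (φ.modular_mono ?_) hα.2⟩
    filter_upwards [φ.ae_isOrliczFunction] with ω hω
    by_cases h : ω ∈ A
    · rw [Set.indicator_of_mem h]
    · rw [Set.indicator_of_notMem h, smul_zero, hω.map_zero]
      exact zero_le⟩

open Classical in
/-- The set function `ν_{ℓ,u} : A ↦ ℓ(u χ_A)` on measurable sets, extended by `0` to all other
sets. -/
noncomputable def OrliczIntegrand.setFunction (φ : OrliczIntegrand μ X)
    (ℓ : φ.space →L[ℝ] ℝ) (u : φ.space) (A : Set Ω) : ℝ :=
  if hA : MeasurableSet A then ℓ (φ.mulIndicator u A hA) else 0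

end OrliczSpace

/-! ### Classes of finitely additive set functions

Set functions are functions `Set Ω → ℝ` of which only the values on measurable sets matter. -/

/-- `ν` is a bounded, finitely additive set function on the measurable sets. -/
def IsBoundedAdditive {Ω : Type*} [MeasurableSpace Ω] (ν : Set Ω → ℝ) : Prop :=
  (∀ A B : Set Ω, MeasurableSet A → MeasurableSet B → Disjoint A B → ν (A ∪ B) = ν A + ν B) ∧
    ∃ C : ℝ, ∀ A : Set Ω, MeasurableSet A → |ν A| ≤ C

/-- The positive part `ν⁺(A) = sup {ν(B) | B ⊆ A measurable}`. -/
noncomputable def setFunctionPosPart {Ω : Type*} [MeasurableSpace Ω] (ν : Set Ω → ℝ)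
    (A : Set Ω) : ℝ :=
  sSup {r : ℝ | ∃ B : Set Ω, MeasurableSet B ∧ B ⊆ A ∧ ν B = r}

/-- A bounded additive `ν` is purely finitely additive if neither its positive part nor its negative
part dominates a nonzero (countably additive) measure. -/
def IsPurelyFinitelyAdditive {Ω : Type*} [MeasurableSpace Ω] (ν : Set Ω → ℝ) : Prop :=
  IsBoundedAdditive ν ∧
    (∀ m : Measure Ω, (∀ A : Set Ω, MeasurableSet A →
      m A ≤ ENNReal.ofReal (setFunctionPosPart ν A)) → m = 0) ∧
    (∀ m : Measure Ω, (∀ A : Set Ω, MeasurableSet A →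
      m A ≤ ENNReal.ofReal (setFunctionPosPart (-ν) A)) → m = 0)

/-- `ν` is a finite signed measure that is absolutely continuous with respect to `μ` and
concentrated on a set that is sigma-finite for `μ`. -/
def IsAbsolutelyContinuousSetFunction {Ω : Type*} [MeasurableSpace Ω] (μ : Measure Ω)
    (ν : Set Ω → ℝ) : Prop :=
  ∃ s : SignedMeasure Ω, (∀ A : Set Ω, MeasurableSet A → ν A = s A) ∧
    s.totalVariation ≪ μ ∧ ∃ S : Set Ω, IsSigmaFiniteSet μ S ∧ s.totalVariation Sᶜ = 0

/-- `ν` is a finite signed measure that is diffuse with respect to `μ`: its variation vanishes on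
all sets of finite `μ`-measure. -/
def IsDiffuseSetFunction {Ω : Type*} [MeasurableSpace Ω] (μ : Measure Ω)
    (ν : Set Ω → ℝ) : Prop :=
  ∃ s : SignedMeasure Ω, (∀ A : Set Ω, MeasurableSet A → ν A = s A) ∧
    ∀ E : Set Ω, MeasurableSet E → μ E < ∞ → s.totalVariation E = 0

/-! ### Classes of functionals -/

section Functionals

variable {Ω : Type*} [MeasurableSpace Ω] {μ : Measure Ω}
  {X : Type*} [NormedAddCommGroup X] [NormedSpace ℝ X] [MeasurableSpace X] [BorelSpace X]

/-- The absolutely continuous functionals on the Orlicz space. -/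
def OrliczIntegrand.acFunctionals (φ : OrliczIntegrand μ X) : Set (φ.space →L[ℝ] ℝ) :=
  {ℓ | ∀ u : φ.space, IsAbsolutelyContinuousSetFunction μ (φ.setFunction ℓ u)}

/-- The diffuse functionals on the Orlicz space. -/
def OrliczIntegrand.diffuseFunctionals (φ : OrliczIntegrand μ X) : Set (φ.space →L[ℝ] ℝ) :=
  {ℓ | ∀ u : φ.space, IsDiffuseSetFunction μ (φ.setFunction ℓ u)}

/-- The purely finitely additive functionals on the Orlicz space. -/
def OrliczIntegrand.pfaFunctionals (φ : OrliczIntegrand μ X) : Set (φ.space →L[ℝ] ℝ) :=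
  {ℓ | ∀ u : φ.space, IsPurelyFinitelyAdditive (φ.setFunction ℓ u)}

end Functionals

/-! The decomposition is obtained one `u` at a time for the set function ν(A) = ℓ(u χ_A) and then
lifted to functionals. Hewitt–Yosida splits ν into a signed measure and a purely finitely additive
part. The signed measure vanishes on μ-null sets, so cutting it along a suitable σ-finite set leaves
an absolutely continuous part on that set and a diffuse part off it. Each class is a linear space of
set functions stable under restriction to measurable sets, and at each of the two splittings the two
classes involved meet only in zero. Hence the parts depend linearly on `u`, are bounded by ‖ℓ‖‖u‖ at
the whole space, and are themselves set functions of functionals (`exists_add_mem_functionalsOf`).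

Pure finite additivity is handled through an equivalent ε-condition, `IsSingularSetFunction`: for
every finite measure m, the set function is small off some set of small m-measure. This condition is
visibly linear, and one small set can serve several set functions and measures at once
(`isPurelyFinitelyAdditive_iff`).

For the norm, near-maximizers u, v, w of the three parts are spliced: w on a small set C, u on S \ C
and v on Sᶜ \ C, where S is σ-finite. The functionals nearly decouple: the absolutely continuous
values of u and v live on S, the diffuse ones vanish on S, the purely finitely additive ones are
small off C, and the countably additive ones are small on C. The splice costs almost nothing in
modular: u contributes at most 1; S can be enlarged so that v contributes 0, because a finite
modular lives on a σ-finite set; and w contributes at most ε, because its modular is dominated by a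
finite measure that C makes small. Thus the spliced function has norm at most 1 + ε and nearly
attains the sum of the three norms (`norm_add_add_le`). -/

/-! ### Bounded additive set functions and the Hewitt–Yosida decomposition -/

section SetFunctions

variable {Ω : Type*} [MeasurableSpace Ω]

/-- Among the measures dominated by a superadditive set function there is a greatest one; its total
mass is the infimum of the sums of the set function over countable measurable covers. -/
theorem exists_greatest_measure_le (g : Set Ω → ℝ≥0∞) (h0 : g ∅ = 0)
    (hg : ∀ A B : Set Ω, MeasurableSet A → MeasurableSet B → Disjoint A B →
      g A + g B ≤ g (A ∪ B)) :
    ∃ κ : Measure Ω, (∀ A, MeasurableSet A → κ A ≤ g A) ∧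
      (∀ m : Measure Ω, (∀ A, MeasurableSet A → m A ≤ g A) → m ≤ κ) ∧
      ∀ c, κ Set.univ < c → ∃ t : ℕ → Set Ω, (∀ n, MeasurableSet (t n)) ∧
        ⋃ n, t n = Set.univ ∧ ∑' n, g (t n) < c := by
  classical
  -- The value ∞ excludes non-measurable sets from the covers defining the outer measure, so
  -- superadditivity on measurable sets suffices for Carathéodory's condition.
  let g' : Set Ω → ℝ≥0∞ := fun t => if MeasurableSet t then g t else ∞
  have g'_of : ∀ {t}, MeasurableSet t → g' t = g t := fun ht => if_pos ht
  have g'_top : ∀ t, ¬ MeasurableSet t → g' t = ∞ := fun t ht => if_neg ht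
  have h0' : g' ∅ = 0 := by rw [g'_of MeasurableSet.empty, h0]
  have hc : ‹MeasurableSpace Ω› ≤ (OuterMeasure.ofFunction g' h0').caratheodory := by
    intro s hs
    refine OuterMeasure.ofFunction_caratheodory fun t => ?_
    by_cases ht : MeasurableSet t
    · rw [g'_of ht, g'_of (ht.inter hs), g'_of (ht.diff hs)]
      refine (hg _ _ (ht.inter hs) (ht.diff hs) Set.disjoint_sdiff_inter.symm).trans ?_
      rw [Set.inter_union_sdiff]
    · rw [g'_top t ht]
      exact le_top
  refine ⟨(OuterMeasure.ofFunction g' h0').toMeasure hc, fun A hA => ?_, fun m hm => ?_,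
    fun c hlt => ?_⟩
  · rw [toMeasure_apply _ _ hA, ← g'_of hA]
    exact OuterMeasure.ofFunction_le A
  · refine Measure.le_iff.2 fun A hA => ?_
    rw [toMeasure_apply _ _ hA]
    refine (OuterMeasure.le_ofFunction (μ := m.toOuterMeasure)).2 (fun s => ?_) A
    by_cases hs : MeasurableSet s
    · rw [g'_of hs]
      exact hm s hs
    · rw [g'_top s hs]
      exact le_top
  · rw [toMeasure_apply _ _ MeasurableSet.univ,
      OuterMeasure.ofFunction_eq_iInf_mem (P := MeasurableSet) _ _ g'_top] at hlt
    simp only [iInf_lt_iff] at hlt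
    obtain ⟨t, ht, hu, hsum⟩ := hlt
    refine ⟨t, ht, Set.univ_subset_iff.1 hu, ?_⟩
    simpa only [g'_of (ht _)] using hsum

namespace IsBoundedAdditive

variable {ν ν' : Set Ω → ℝ}

theorem map_empty (h : IsBoundedAdditive ν) : ν ∅ = 0 := by
  have := h.1 ∅ ∅ .empty .empty (Set.disjoint_empty _)
  rw [Set.empty_union] at this
  linarith

theorem map_inter_add_sdiff (h : IsBoundedAdditive ν) {A B : Set Ω} (hA : MeasurableSet A)
    (hB : MeasurableSet B) : ν (A ∩ B) + ν (A \ B) = ν A := by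
  rw [← h.1 _ _ (hA.inter hB) (hA.diff hB) Set.disjoint_sdiff_inter.symm, Set.inter_union_sdiff]

theorem map_sdiff (h : IsBoundedAdditive ν) {A B : Set Ω} (hA : MeasurableSet A)
    (hB : MeasurableSet B) (hAB : B ⊆ A) : ν (A \ B) = ν A - ν B := by
  have := h.map_inter_add_sdiff hA hB
  rw [Set.inter_eq_self_of_subset_right hAB] at this
  linarith

theorem congr (h : IsBoundedAdditive ν) (e : ∀ A, MeasurableSet A → ν A = ν' A) :
    IsBoundedAdditive ν' := by
  obtain ⟨h1, C, hC⟩ := h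
  refine ⟨fun A B hA hB hd => ?_, C, fun A hA => by rw [← e A hA]; exact hC A hA⟩
  rw [← e _ (hA.union hB), ← e A hA, ← e B hB, h1 A B hA hB hd]

theorem zero : IsBoundedAdditive (0 : Set Ω → ℝ) :=
  ⟨fun _ _ _ _ _ => by simp, 0, fun _ _ => by simp⟩

theorem add (h : IsBoundedAdditive ν) (h' : IsBoundedAdditive ν') :
    IsBoundedAdditive (ν + ν') := by
  obtain ⟨h1, C, hC⟩ := h
  obtain ⟨h1', C', hC'⟩ := h'
  refine ⟨fun A B hA hB hd => ?_, C + C', fun A hA =>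
    (abs_add_le _ _).trans (add_le_add (hC A hA) (hC' A hA))⟩
  simp only [Pi.add_apply, h1 A B hA hB hd, h1' A B hA hB hd]
  ring

theorem smul (h : IsBoundedAdditive ν) (c : ℝ) : IsBoundedAdditive (c • ν) := by
  obtain ⟨h1, C, hC⟩ := h
  refine ⟨fun A B hA hB hd => ?_, |c| * C, fun A hA => ?_⟩
  · simp only [Pi.smul_apply, smul_eq_mul, h1 A B hA hB hd]
    ring
  · rw [Pi.smul_apply, smul_eq_mul, abs_mul]
    exact mul_le_mul_of_nonneg_left (hC A hA) (abs_nonneg c)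

theorem neg (h : IsBoundedAdditive ν) : IsBoundedAdditive (-ν) := by
  simpa using h.smul (-1)

theorem sub (h : IsBoundedAdditive ν) (h' : IsBoundedAdditive ν') :
    IsBoundedAdditive (ν - ν') := by
  simpa [sub_eq_add_neg] using h.add h'.neg

theorem inter (h : IsBoundedAdditive ν) {E : Set Ω} (hE : MeasurableSet E) :
    IsBoundedAdditive fun A => ν (A ∩ E) := by
  obtain ⟨h1, C, hC⟩ := h
  refine ⟨fun A B hA hB hd => ?_, C, fun A hA => hC _ (hA.inter hE)⟩
  change ν ((A ∪ B) ∩ E) = _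
  rw [Set.union_inter_distrib_right]
  exact h1 _ _ (hA.inter hE) (hB.inter hE)
    (hd.mono Set.inter_subset_left Set.inter_subset_left)

theorem measureReal (m : Measure Ω) [IsFiniteMeasure m] : IsBoundedAdditive fun A => m.real A :=
  ⟨fun _ _ _ hB hd => measureReal_union hd hB, m.real Set.univ, fun A _ => by
    rw [abs_of_nonneg measureReal_nonneg]
    exact measureReal_mono (Set.subset_univ A)⟩

theorem signedMeasure (s : SignedMeasure Ω) : IsBoundedAdditive s := by
  refine ⟨fun _ _ hA hB hd => s.of_union hd hA hB, s.totalVariation.real Set.univ, fun A _ => ?_⟩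
  exact (s.norm_le_totalVariation A).trans (measureReal_mono (Set.subset_univ A))

theorem mono_of_nonneg (h : IsBoundedAdditive ν) (hn : ∀ A, MeasurableSet A → 0 ≤ ν A)
    {A B : Set Ω} (hA : MeasurableSet A) (hB : MeasurableSet B) (hAB : A ⊆ B) : ν A ≤ ν B := by
  have := h.map_sdiff hB hA hAB
  linarith [hn _ (hB.diff hA)]

theorem union_le_of_nonneg (h : IsBoundedAdditive ν) (hn : ∀ A, MeasurableSet A → 0 ≤ ν A)
    {A B : Set Ω} (hA : MeasurableSet A) (hB : MeasurableSet B) : ν (A ∪ B) ≤ ν A + ν B := by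
  rw [← Set.union_sdiff_self, h.1 A _ hA (hB.diff hA) Set.disjoint_sdiff_right]
  linarith [h.mono_of_nonneg hn (hB.diff hA) hB Set.sdiff_subset]

theorem posPart_bddAbove (h : IsBoundedAdditive ν) (A : Set Ω) :
    BddAbove {r : ℝ | ∃ B : Set Ω, MeasurableSet B ∧ B ⊆ A ∧ ν B = r} := by
  obtain ⟨C, hC⟩ := h.2
  refine ⟨C, ?_⟩
  rintro _ ⟨B, hB, -, rfl⟩
  exact (le_abs_self _).trans (hC B hB)

theorem le_posPart (h : IsBoundedAdditive ν) {A B : Set Ω} (hB : MeasurableSet B) (hBA : B ⊆ A) :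
    ν B ≤ setFunctionPosPart ν A :=
  le_csSup (h.posPart_bddAbove A) ⟨B, hB, hBA, rfl⟩

theorem posPart_nonneg (h : IsBoundedAdditive ν) (A : Set Ω) : 0 ≤ setFunctionPosPart ν A := by
  simpa [h.map_empty] using h.le_posPart (A := A) .empty (Set.empty_subset A)

end IsBoundedAdditive

theorem setFunctionPosPart_le {ν : Set Ω → ℝ} {A : Set Ω} {c : ℝ}
    (h : ∀ B, MeasurableSet B → B ⊆ A → ν B ≤ c) : setFunctionPosPart ν A ≤ c := by
  refine csSup_le ⟨ν ∅, ∅, .empty, Set.empty_subset A, rfl⟩ ?_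
  rintro _ ⟨B, hB, hBA, rfl⟩
  exact h B hB hBA

namespace IsBoundedAdditive

variable {ν ν' : Set Ω → ℝ}

/-- Passing from B to A \ B exchanges the two suprema, since ν(B) = ν(A) + (-ν)(A \ B). -/
theorem posPart_sub_posPart_neg (h : IsBoundedAdditive ν) {A : Set Ω} (hA : MeasurableSet A) :
    setFunctionPosPart ν A - setFunctionPosPart (-ν) A = ν A := by
  have h1 : setFunctionPosPart ν A ≤ ν A + setFunctionPosPart (-ν) A := by
    refine setFunctionPosPart_le fun B hB hBA => ?_
    have := h.neg.le_posPart (hA.diff hB) (A := A) Set.sdiff_subset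
    rw [Pi.neg_apply, h.map_sdiff hA hB hBA] at this
    linarith
  have h2 : setFunctionPosPart (-ν) A ≤ setFunctionPosPart ν A - ν A := by
    refine setFunctionPosPart_le fun B hB hBA => ?_
    have := h.le_posPart (hA.diff hB) (A := A) Set.sdiff_subset
    rw [h.map_sdiff hA hB hBA] at this
    rw [Pi.neg_apply]
    linarith
  linarith

theorem posPart (h : IsBoundedAdditive ν) : IsBoundedAdditive (setFunctionPosPart ν) := by
  refine ⟨fun A B hA hB hd => le_antisymm ?_ ?_, ?_⟩
  · refine setFunctionPosPart_le fun D hD hDA => ?_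
    rw [← h.map_inter_add_sdiff hD hA]
    refine add_le_add (h.le_posPart (hD.inter hA) Set.inter_subset_right)
      (h.le_posPart (hD.diff hA) ?_)
    exact Set.sdiff_subset_iff.2 hDA
  · rw [← le_sub_iff_add_le]
    refine setFunctionPosPart_le fun D hD hDA => ?_
    rw [le_sub_comm]
    refine setFunctionPosPart_le fun E hE hEB => ?_
    rw [le_sub_iff_add_le', ← h.1 D E hD hE (hd.mono hDA hEB)]
    exact h.le_posPart (hD.union hE) (Set.union_subset_union hDA hEB)
  · obtain ⟨C, hC⟩ := h.2
    refine ⟨C, fun A _ => ?_⟩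
    rw [abs_of_nonneg (h.posPart_nonneg A)]
    exact setFunctionPosPart_le fun B hB _ => (le_abs_self _).trans (hC B hB)

theorem abs_le_max_posPart (h : IsBoundedAdditive ν) {A B : Set Ω} (hB : MeasurableSet B)
    (hBA : B ⊆ A) : |ν B| ≤ max (setFunctionPosPart ν A) (setFunctionPosPart (-ν) A) :=
  abs_le'.2 ⟨(h.le_posPart hB hBA).trans (le_max_left _ _),
    (h.neg.le_posPart hB hBA).trans (le_max_right _ _)⟩

end IsBoundedAdditive

/-- `ν` is singular to every finite measure: up to `ε` it lives on a set of measure at most `ε`. -/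
def IsSingularSetFunction (ν : Set Ω → ℝ) : Prop :=
  ∀ (m : Measure Ω) [IsFiniteMeasure m] (ε : ℝ), 0 < ε →
    ∃ C, MeasurableSet C ∧ m.real C ≤ ε ∧ ∀ B, MeasurableSet B → B ⊆ Cᶜ → |ν B| ≤ ε

/-- The greatest measure below min(ν, m) lies below ν, hence is zero. So the space has countable
covers with arbitrarily small sum of min(ν, m), and sorting the pieces by which of the two values is
smaller separates ν from m. -/
theorem IsBoundedAdditive.isSingular_of_nonneg {ν : Set Ω → ℝ} (h : IsBoundedAdditive ν)
    (hn : ∀ A, MeasurableSet A → 0 ≤ ν A)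
    (hm : ∀ m : Measure Ω, (∀ A, MeasurableSet A → m A ≤ ENNReal.ofReal (ν A)) → m = 0) :
    IsSingularSetFunction ν := by
  classical
  intro m _ ε hε
  have hε' : 0 < ENNReal.ofReal ε := ENNReal.ofReal_pos.2 hε
  obtain ⟨κ, hκ, -, hcov⟩ := exists_greatest_measure_le
    (fun A => min (ENNReal.ofReal (ν A)) (m A)) (by simp) (by
      intro A B hA hB hd
      refine le_min ?_ ?_
      · rw [h.1 A B hA hB hd, ENNReal.ofReal_add (hn A hA) (hn B hB)]
        exact add_le_add (min_le_left _ _) (min_le_left _ _)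
      · rw [measure_union hd hB]
        exact add_le_add (min_le_right _ _) (min_le_right _ _))
  have hκ0 : κ = 0 := hm κ fun A hA => (hκ A hA).trans (min_le_left _ _)
  obtain ⟨t, ht, hu, hsum⟩ := hcov (ENNReal.ofReal ε) (by simpa [hκ0] using hε')
  -- The `p n` are the pieces on which ν realizes the minimum, the `q n` those on which m does; each
  -- family has total at most the sum of the minima.
  let P : ℕ → Prop := fun n => ENNReal.ofReal (ν (t n)) ≤ m (t n)
  let p : ℕ → Set Ω := fun n => if P n then t n else ∅
  let q : ℕ → Set Ω := fun n => if P n then ∅ else t n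
  have hp : ∀ n, MeasurableSet (p n) := fun n => by
    by_cases hP : P n <;> simp [p, hP, ht n]
  have hνp : ∀ n, ENNReal.ofReal (ν (p n)) ≤ min (ENNReal.ofReal (ν (t n))) (m (t n)) := fun n => by
    by_cases hP : P n
    · simp only [p, hP, if_true]
      exact le_min le_rfl hP
    · simp [p, hP, h.map_empty]
  have hmq : ∀ n, m (q n) ≤ min (ENNReal.ofReal (ν (t n))) (m (t n)) := fun n => by
    by_cases hP : P n
    · simp [q, hP]
    · simp only [q, hP, if_false]
      exact le_min (not_le.1 hP).le le_rfl
  -- Only finite unions are controlled by ν, which is merely finitely subadditive. Countable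
  -- additivity of m compensates: what all the `D N` miss is covered by the `q n`, and continuity
  -- from above then yields one good N.
  let D : ℕ → Set Ω := fun N => ⋃ n ∈ Finset.range N, p n
  have hD : ∀ N, MeasurableSet (D N) := fun N =>
    Finset.measurableSet_biUnion _ fun n _ => hp n
  have hDmono : Monotone D := fun M N hMN =>
    Set.biUnion_subset_biUnion_left fun n hn => Finset.range_mono hMN hn
  have hνD : ∀ N, ENNReal.ofReal (ν (D N)) ≤ ENNReal.ofReal ε := by
    intro N
    have h1 : ∀ N, ENNReal.ofReal (ν (D N)) ≤ ∑ n ∈ Finset.range N, ENNReal.ofReal (ν (p n)) := by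
      intro N
      induction N with
      | zero => simp [D, h.map_empty]
      | succ N ih =>
        have e : D (N + 1) = D N ∪ p N := by
          simp only [D, Finset.range_add_one, Finset.set_biUnion_insert]
          exact Set.union_comm _ _
        rw [e, Finset.sum_range_succ]
        refine (ENNReal.ofReal_le_ofReal (h.union_le_of_nonneg hn (hD N) (hp N))).trans ?_
        rw [ENNReal.ofReal_add (hn _ (hD N)) (hn _ (hp N))]
        gcongr
    exact ((h1 N).trans ((Finset.sum_le_sum fun n _ => hνp n).trans
      (ENNReal.sum_le_tsum _))).trans hsum.le
  have hlim : m (⋂ N, (D N)ᶜ) < ENNReal.ofReal ε := by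
    have hsub : (⋂ N, (D N)ᶜ) ⊆ ⋃ n, q n := by
      intro ω hω
      obtain ⟨n, hn⟩ := Set.mem_iUnion.1 (hu.symm ▸ Set.mem_univ ω : ω ∈ ⋃ n, t n)
      refine Set.mem_iUnion.2 ⟨n, ?_⟩
      by_cases hP : P n
      · refine absurd ?_ (Set.mem_iInter.1 hω (n + 1))
        exact Set.mem_biUnion (Finset.self_mem_range_succ n) (by simpa [p, hP] using hn)
      · simpa [q, hP] using hn
    exact ((measure_mono hsub).trans ((measure_iUnion_le q).trans
      (ENNReal.tsum_le_tsum hmq))).trans_lt hsum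
  have htend := tendsto_measure_iInter_atTop (μ := m) (s := fun N => (D N)ᶜ)
    (fun N => (hD N).compl.nullMeasurableSet)
    (fun M N hMN => Set.compl_subset_compl.2 (hDmono hMN)) ⟨0, measure_ne_top m _⟩
  obtain ⟨N, hN⟩ := (htend.eventually_lt_const hlim).exists
  refine ⟨(D N)ᶜ, (hD N).compl, ?_, fun B hB hBD => ?_⟩
  · exact ENNReal.toReal_le_of_le_ofReal hε.le hN.le
  · rw [compl_compl] at hBD
    rw [abs_of_nonneg (hn B hB)]
    exact (h.mono_of_nonneg hn hB (hD N) hBD).trans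
      ((ENNReal.ofReal_le_ofReal_iff hε.le).1 (hνD N))

namespace IsSingularSetFunction

variable {ν ν' : Set Ω → ℝ}

theorem congr (h : IsSingularSetFunction ν) (e : ∀ A, MeasurableSet A → ν A = ν' A) :
    IsSingularSetFunction ν' := by
  intro m _ ε hε
  obtain ⟨C, hC, h1, h2⟩ := h m ε hε
  exact ⟨C, hC, h1, fun B hB hBC => by rw [← e B hB]; exact h2 B hB hBC⟩

theorem zero : IsSingularSetFunction (0 : Set Ω → ℝ) := fun _ _ ε hε =>
  ⟨∅, .empty, by simpa using hε.le, fun _ _ _ => by simpa using hε.le⟩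

/-- Finitely many singular set functions can be handled by one small set. -/
theorem exists_common (h : IsSingularSetFunction ν) (h' : IsSingularSetFunction ν')
    (m : Measure Ω) [IsFiniteMeasure m] {ε : ℝ} (hε : 0 < ε) :
    ∃ C, MeasurableSet C ∧ m.real C ≤ ε ∧
      ∀ B, MeasurableSet B → B ⊆ Cᶜ → |ν B| ≤ ε ∧ |ν' B| ≤ ε := by
  obtain ⟨C, hC, h1, h2⟩ := h m (ε / 2) (half_pos hε)
  obtain ⟨C', hC', h1', h2'⟩ := h' m (ε / 2) (half_pos hε)
  refine ⟨C ∪ C', hC.union hC', (measureReal_union_le _ _).trans (by linarith), fun B hB hBC => ?_⟩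
  rw [Set.compl_union, Set.subset_inter_iff] at hBC
  exact ⟨(h2 B hB hBC.1).trans (half_le_self hε.le), (h2' B hB hBC.2).trans (half_le_self hε.le)⟩

theorem add (h : IsSingularSetFunction ν) (h' : IsSingularSetFunction ν') :
    IsSingularSetFunction (ν + ν') := by
  intro m _ ε hε
  obtain ⟨C, hC, h1, h2⟩ := h.exists_common h' m (half_pos hε)
  refine ⟨C, hC, h1.trans (half_le_self hε.le), fun B hB hBC => (abs_add_le _ _).trans ?_⟩
  linarith [(h2 B hB hBC).1, (h2 B hB hBC).2]

theorem smul (h : IsSingularSetFunction ν) (c : ℝ) : IsSingularSetFunction (c • ν) := by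
  intro m _ ε hε
  have hc : (0 : ℝ) < |c| + 1 := by positivity
  obtain ⟨C, hC, h1, h2⟩ := h m (ε / (|c| + 1)) (div_pos hε hc)
  refine ⟨C, hC, h1.trans (div_le_self hε.le (by linarith [abs_nonneg c])), fun B hB hBC => ?_⟩
  rw [Pi.smul_apply, smul_eq_mul, abs_mul]
  have := h2 B hB hBC
  rw [le_div_iff₀ hc] at this
  nlinarith [abs_nonneg (ν B)]

theorem inter (h : IsSingularSetFunction ν) {E : Set Ω} (hE : MeasurableSet E) :
    IsSingularSetFunction fun A => ν (A ∩ E) := by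
  intro m _ ε hε
  obtain ⟨C, hC, h1, h2⟩ := h m ε hε
  exact ⟨C, hC, h1, fun B hB hBC => h2 _ (hB.inter hE) (Set.inter_subset_left.trans hBC)⟩

/-- The dominated measure is finite, so it may serve as its own test measure: it is small on C by
choice of C, and small off C because it lies below the positive part of ν. -/
theorem measure_eq_zero_of_le_posPart (h : IsSingularSetFunction ν)
    {m : Measure Ω} (hm : ∀ A, MeasurableSet A → m A ≤ ENNReal.ofReal (setFunctionPosPart ν A)) :
    m = 0 := by
  have : IsFiniteMeasure m := ⟨(hm _ .univ).trans_lt ENNReal.ofReal_lt_top⟩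
  have key : m.real Set.univ ≤ 0 := by
    refine le_of_forall_pos_le_add fun ε hε => ?_
    obtain ⟨C, hC, h1, h2⟩ := h m (ε / 2) (half_pos hε)
    have h3 : m.real Cᶜ ≤ ε / 2 := by
      refine ENNReal.toReal_le_of_le_ofReal (half_pos hε).le ((hm _ hC.compl).trans ?_)
      exact ENNReal.ofReal_le_ofReal
        (setFunctionPosPart_le fun B hB hBC => (le_abs_self _).trans (h2 B hB hBC))
    rw [← measureReal_add_measureReal_compl hC]
    linarith
  rw [← Measure.measure_univ_eq_zero, ← measureReal_eq_zero_iff]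
  exact le_antisymm key measureReal_nonneg

end IsSingularSetFunction

/-- Stability under sums is not apparent from a definition through positive and negative parts; it
is immediate for the ε-condition. -/
theorem isPurelyFinitelyAdditive_iff {ν : Set Ω → ℝ} :
    IsPurelyFinitelyAdditive ν ↔ IsBoundedAdditive ν ∧ IsSingularSetFunction ν := by
  constructor
  · rintro ⟨hb, h1, h2⟩
    refine ⟨hb, ?_⟩
    have s1 := hb.posPart.isSingular_of_nonneg (fun A _ => hb.posPart_nonneg A) h1
    have s2 := hb.neg.posPart.isSingular_of_nonneg (fun A _ => hb.neg.posPart_nonneg A) h2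
    intro m _ ε hε
    obtain ⟨C, hC, hm, hB⟩ := s1.exists_common s2 m hε
    exact ⟨C, hC, hm, fun B hBm hBC => (hb.abs_le_max_posPart hBm le_rfl).trans
      (max_le ((le_abs_self _).trans (hB B hBm hBC).1) ((le_abs_self _).trans (hB B hBm hBC).2))⟩
  · rintro ⟨hb, hs⟩
    refine ⟨hb, fun m hm => hs.measure_eq_zero_of_le_posPart hm, fun m hm => ?_⟩
    refine IsSingularSetFunction.measure_eq_zero_of_le_posPart (ν := -ν) ?_ hm
    simpa using hs.smul (-1)

/-- A nonnegative bounded additive set function is the sum of a measure and a purely finitely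
additive one. -/
theorem IsBoundedAdditive.exists_measure_of_nonneg {ν : Set Ω → ℝ} (h : IsBoundedAdditive ν)
    (hn : ∀ A, MeasurableSet A → 0 ≤ ν A) :
    ∃ κ : Measure Ω, IsFiniteMeasure κ ∧ (∀ A, MeasurableSet A → κ.real A ≤ ν A) ∧
      IsSingularSetFunction fun A => ν A - κ.real A := by
  obtain ⟨κ, hκ, hmax, -⟩ := exists_greatest_measure_le (fun A => ENNReal.ofReal (ν A))
    (by simp [h.map_empty]) (fun A B hA hB hd => by
      rw [h.1 A B hA hB hd, ENNReal.ofReal_add (hn A hA) (hn B hB)])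
  have hfin : IsFiniteMeasure κ := ⟨(hκ _ .univ).trans_lt ENNReal.ofReal_lt_top⟩
  have hle : ∀ A, MeasurableSet A → κ.real A ≤ ν A := fun A hA =>
    ENNReal.toReal_le_of_le_ofReal (hn A hA) (hκ A hA)
  refine ⟨κ, hfin, hle, ?_⟩
  have hb : IsBoundedAdditive fun A => ν A - κ.real A :=
    h.sub (IsBoundedAdditive.measureReal κ)
  refine hb.isSingular_of_nonneg (fun A hA => sub_nonneg.2 (hle A hA)) fun m hm => ?_
  -- A measure below ν - κ can be added to κ without exceeding ν, so maximality of κ forces it to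
  -- vanish.
  have hsum : m + κ ≤ κ := hmax _ fun A hA => by
    rw [Measure.add_apply, ← ofReal_measureReal (μ := κ) (s := A)]
    refine (add_le_add_left (hm A hA) _).trans ?_
    rw [← ENNReal.ofReal_add (sub_nonneg.2 (hle A hA)) measureReal_nonneg, sub_add_cancel]
  rw [← Measure.measure_univ_eq_zero]
  have h1 := hsum Set.univ
  rw [Measure.add_apply] at h1
  have h2 : m Set.univ + κ Set.univ ≤ 0 + κ Set.univ := by rwa [zero_add]
  exact nonpos_iff_eq_zero.1 ((ENNReal.add_le_add_iff_right (measure_ne_top κ _)).1 h2)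

/-- The Hewitt–Yosida decomposition. -/
theorem IsBoundedAdditive.exists_signedMeasure_add_isSingular {ν : Set Ω → ℝ}
    (h : IsBoundedAdditive ν) {C : ℝ} (hC : ∀ A, MeasurableSet A → |ν A| ≤ C) :
    ∃ s : SignedMeasure Ω, IsSingularSetFunction (ν - ⇑s) ∧ |s Set.univ| ≤ C := by
  obtain ⟨κ, _, h1, h2⟩ := h.posPart.exists_measure_of_nonneg fun A _ => h.posPart_nonneg A
  obtain ⟨κ', _, h1', h2'⟩ := h.neg.posPart.exists_measure_of_nonneg fun A _ => h.neg.posPart_nonneg A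
  refine ⟨κ.toSignedMeasure - κ'.toSignedMeasure, ?_, ?_⟩
  · refine (h2.add (h2'.smul (-1))).congr fun A hA => ?_
    rw [Pi.sub_apply, Measure.toSignedMeasure_sub_apply hA, ← h.posPart_sub_posPart_neg hA]
    simp only [Pi.add_apply, Pi.smul_apply, smul_eq_mul]
    ring
  -- Both masses lie in [0, C], so their difference lies in [-C, C]. Keeping the same constant is
  -- what later bounds the countably additive component by ‖ℓ‖‖u‖.
  · rw [Measure.toSignedMeasure_sub_apply .univ]
    have e1 := (h1 _ .univ).trans (setFunctionPosPart_le (c := C)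
      fun B hB _ => (le_abs_self _).trans (hC B hB))
    have e2 := (h1' _ .univ).trans (setFunctionPosPart_le (c := C)
      fun B hB _ => (neg_le_abs _).trans (hC B hB))
    rw [abs_le]
    constructor <;> linarith [measureReal_nonneg (μ := κ) (s := Set.univ),
      measureReal_nonneg (μ := κ') (s := Set.univ)]

end SetFunctions

/-! ### Absolutely continuous, diffuse and purely finitely additive classes -/

section SetFunctionClasses

variable {Ω : Type*} [MeasurableSpace Ω]

/-- For the converse, test on the two pieces of E cut out by a Hahn decomposition. -/
theorem MeasureTheory.SignedMeasure.totalVariation_eq_zero_iff (s : SignedMeasure Ω) {E : Set Ω}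
    (hE : MeasurableSet E) :
    s.totalVariation E = 0 ↔ ∀ B, MeasurableSet B → B ⊆ E → s B = 0 := by
  constructor
  · exact fun h B _ hBE => s.null_of_totalVariation_zero (measure_mono_null hBE h)
  · intro h
    obtain ⟨i, hi, h1, h2, e1, e2⟩ := s.toJordanDecomposition_spec
    rw [SignedMeasure.totalVariation, Measure.add_apply, e1, e2,
      s.toMeasureOfZeroLE_apply h1 hi hE, s.toMeasureOfLEZero_apply h2 hi.compl hE]
    have z1 := h _ (hi.inter hE) Set.inter_subset_right
    have z2 := h _ (hi.compl.inter hE) Set.inter_subset_right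
    simp [z1, z2]

theorem MeasureTheory.SignedMeasure.abs_le_totalVariation_of_subset (s : SignedMeasure Ω)
    {B C : Set Ω} (hBC : B ⊆ C) : |s B| ≤ s.totalVariation.real C :=
  (s.norm_le_totalVariation B).trans (measureReal_mono hBC)

theorem IsSigmaFiniteSet.measurableSet {μ : Measure Ω} {S : Set Ω} (h : IsSigmaFiniteSet μ S) :
    MeasurableSet S := by
  obtain ⟨B, hB, rfl⟩ := h
  exact .iUnion fun n => (hB n).1

theorem IsSigmaFiniteSet.union {μ : Measure Ω} {S T : Set Ω} (hS : IsSigmaFiniteSet μ S)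
    (hT : IsSigmaFiniteSet μ T) : IsSigmaFiniteSet μ (S ∪ T) := by
  obtain ⟨B, hB, rfl⟩ := hS
  obtain ⟨C, hC, rfl⟩ := hT
  exact ⟨fun n => B n ∪ C n, fun n => ⟨(hB n).1.union (hC n).1,
    measure_union_lt_top (hB n).2 (hC n).2⟩, Set.iUnion_union_distrib B C |>.symm⟩

theorem IsSigmaFiniteSet.empty {μ : Measure Ω} : IsSigmaFiniteSet μ ∅ :=
  ⟨fun _ => ∅, fun _ => ⟨.empty, by simp⟩, by simp⟩

theorem isSigmaFiniteSet_sigmaFiniteSetWRT (μ ν : Measure Ω) :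
    IsSigmaFiniteSet μ (μ.sigmaFiniteSetWRT ν) := by
  have hm : MeasurableSet (μ.sigmaFiniteSetWRT ν) := measurableSet_sigmaFiniteSetWRT
  refine ⟨fun n => spanningSets (μ.restrict (μ.sigmaFiniteSetWRT ν)) n ∩ μ.sigmaFiniteSetWRT ν,
    fun n => ⟨(measurableSet_spanningSets _ n).inter hm, ?_⟩, ?_⟩
  · rw [← Measure.restrict_apply (measurableSet_spanningSets _ n)]
    exact measure_spanningSets_lt_top _ n
  · rw [← Set.iUnion_inter, iUnion_spanningSets, Set.univ_inter]

/-- A class of set functions, seen only through their values on measurable sets, that is a linear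
subspace and is stable under restriction to measurable sets. -/
structure IsRestrictionStable (P : (Set Ω → ℝ) → Prop) : Prop where
  congr : ∀ {ν ν' : Set Ω → ℝ}, P ν → (∀ A, MeasurableSet A → ν A = ν' A) → P ν'
  zero : P 0
  add : ∀ {ν ν' : Set Ω → ℝ}, P ν → P ν' → P (ν + ν')
  smul : ∀ {ν : Set Ω → ℝ} (c : ℝ), P ν → P (c • ν)
  inter : ∀ {ν : Set Ω → ℝ}, P ν → ∀ {E : Set Ω}, MeasurableSet E → P fun A => ν (A ∩ E)

/-- `ν` is countably additive on the measurable sets. -/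
def IsSignedMeasureSetFunction (ν : Set Ω → ℝ) : Prop :=
  ∃ s : SignedMeasure Ω, ∀ A, MeasurableSet A → ν A = s A

theorem IsSignedMeasureSetFunction.isRestrictionStable :
    IsRestrictionStable (IsSignedMeasureSetFunction (Ω := Ω)) where
  congr := fun ⟨s, hs⟩ e => ⟨s, fun A hA => (e A hA).symm.trans (hs A hA)⟩
  zero := ⟨0, fun A _ => by simp⟩
  add := fun ⟨s, hs⟩ ⟨s', hs'⟩ => ⟨s + s', fun A hA => by simp [hs A hA, hs' A hA]⟩
  smul := fun c ⟨s, hs⟩ => ⟨c • s, fun A hA => by simp [hs A hA]⟩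
  inter := fun ⟨s, hs⟩ E hE => ⟨s.restrict E, fun A hA => by
    rw [VectorMeasure.restrict_apply _ hE hA, ← hs _ (hA.inter hE)]⟩

theorem IsPurelyFinitelyAdditive.isRestrictionStable :
    IsRestrictionStable (IsPurelyFinitelyAdditive (Ω := Ω)) where
  congr h e := by
    rw [isPurelyFinitelyAdditive_iff] at h ⊢
    exact ⟨h.1.congr e, h.2.congr e⟩
  zero := isPurelyFinitelyAdditive_iff.2 ⟨.zero, .zero⟩
  add h h' := by
    rw [isPurelyFinitelyAdditive_iff] at h h' ⊢
    exact ⟨h.1.add h'.1, h.2.add h'.2⟩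
  smul c h := by
    rw [isPurelyFinitelyAdditive_iff] at h ⊢
    exact ⟨h.1.smul c, h.2.smul c⟩
  inter h _ hE := by
    rw [isPurelyFinitelyAdditive_iff] at h ⊢
    exact ⟨h.1.inter hE, h.2.inter hE⟩

/-- Null sets and subsets of Sᶜ are hereditary families, so vanishing of the variation can be read
off from the values of ν. In this form linearity and restriction need no computation with
variations. -/
theorem isAbsolutelyContinuousSetFunction_iff {μ : Measure Ω} {ν : Set Ω → ℝ} :
    IsAbsolutelyContinuousSetFunction μ ν ↔ IsSignedMeasureSetFunction ν ∧
      (∀ A, MeasurableSet A → μ A = 0 → ν A = 0) ∧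
      ∃ S, IsSigmaFiniteSet μ S ∧ ∀ A, MeasurableSet A → A ⊆ Sᶜ → ν A = 0 := by
  constructor
  · rintro ⟨s, hs, hac, S, hS, hz⟩
    refine ⟨⟨s, hs⟩, fun A hA h0 => ?_, S, hS, fun A hA hAS => ?_⟩
    · rw [hs A hA]
      exact s.null_of_totalVariation_zero (hac h0)
    · rw [hs A hA]
      exact s.null_of_totalVariation_zero (measure_mono_null hAS hz)
  · rintro ⟨⟨s, hs⟩, hac, S, hS, hz⟩
    refine ⟨s, hs, Measure.AbsolutelyContinuous.mk fun A hA h0 => ?_, S, hS, ?_⟩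
    · refine (s.totalVariation_eq_zero_iff hA).2 fun B hB hBA => ?_
      rw [← hs B hB]
      exact hac B hB (measure_mono_null hBA h0)
    · refine (s.totalVariation_eq_zero_iff hS.measurableSet.compl).2 fun B hB hBS => ?_
      rw [← hs B hB]
      exact hz B hB hBS

theorem isDiffuseSetFunction_iff {μ : Measure Ω} {ν : Set Ω → ℝ} :
    IsDiffuseSetFunction μ ν ↔ IsSignedMeasureSetFunction ν ∧
      ∀ A, MeasurableSet A → μ A < ∞ → ν A = 0 := by
  constructor
  · rintro ⟨s, hs, hz⟩
    refine ⟨⟨s, hs⟩, fun A hA hf => ?_⟩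
    rw [hs A hA]
    exact s.null_of_totalVariation_zero (hz A hA hf)
  · rintro ⟨⟨s, hs⟩, hz⟩
    refine ⟨s, hs, fun A hA hf => (s.totalVariation_eq_zero_iff hA).2 fun B hB hBA => ?_⟩
    rw [← hs B hB]
    exact hz B hB ((measure_mono hBA).trans_lt hf)

theorem IsDiffuseSetFunction.eq_zero_of_subset {μ : Measure Ω} {ν : Set Ω → ℝ}
    (h : IsDiffuseSetFunction μ ν) {S A : Set Ω} (hS : IsSigmaFiniteSet μ S)
    (hA : MeasurableSet A) (hAS : A ⊆ S) : ν A = 0 := by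
  obtain ⟨s, hs, hz⟩ := h
  obtain ⟨B, hB, rfl⟩ := hS
  rw [hs A hA]
  exact s.null_of_totalVariation_zero (measure_mono_null hAS
    (measure_iUnion_null fun n => hz _ (hB n).1 (hB n).2))

theorem IsAbsolutelyContinuousSetFunction.isRestrictionStable (μ : Measure Ω) :
    IsRestrictionStable (IsAbsolutelyContinuousSetFunction μ) where
  congr h e := by
    rw [isAbsolutelyContinuousSetFunction_iff] at h ⊢
    obtain ⟨h1, h2, S, hS, h3⟩ := h
    exact ⟨IsSignedMeasureSetFunction.isRestrictionStable.congr h1 e,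
      fun A hA h0 => by rw [← e A hA]; exact h2 A hA h0, S, hS,
      fun A hA h0 => by rw [← e A hA]; exact h3 A hA h0⟩
  zero := isAbsolutelyContinuousSetFunction_iff.2
    ⟨IsSignedMeasureSetFunction.isRestrictionStable.zero, fun _ _ _ => rfl, ∅, .empty,
      fun _ _ _ => rfl⟩
  add h h' := by
    rw [isAbsolutelyContinuousSetFunction_iff] at h h' ⊢
    obtain ⟨h1, h2, S, hS, h3⟩ := h
    obtain ⟨h1', h2', S', hS', h3'⟩ := h'
    refine ⟨IsSignedMeasureSetFunction.isRestrictionStable.add h1 h1',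
      fun A hA h0 => by simp [h2 A hA h0, h2' A hA h0], S ∪ S', hS.union hS', fun A hA hAS => ?_⟩
    rw [Set.compl_union, Set.subset_inter_iff] at hAS
    simp [h3 A hA hAS.1, h3' A hA hAS.2]
  smul c h := by
    rw [isAbsolutelyContinuousSetFunction_iff] at h ⊢
    obtain ⟨h1, h2, S, hS, h3⟩ := h
    exact ⟨IsSignedMeasureSetFunction.isRestrictionStable.smul c h1,
      fun A hA h0 => by simp [h2 A hA h0], S, hS, fun A hA h0 => by simp [h3 A hA h0]⟩
  inter h E hE := by
    rw [isAbsolutelyContinuousSetFunction_iff] at h ⊢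
    obtain ⟨h1, h2, S, hS, h3⟩ := h
    exact ⟨IsSignedMeasureSetFunction.isRestrictionStable.inter h1 hE,
      fun A hA h0 => h2 _ (hA.inter hE) (measure_mono_null Set.inter_subset_left h0), S, hS,
      fun A hA h0 => h3 _ (hA.inter hE) (Set.inter_subset_left.trans h0)⟩

theorem IsDiffuseSetFunction.isRestrictionStable (μ : Measure Ω) :
    IsRestrictionStable (IsDiffuseSetFunction μ) where
  congr h e := by
    rw [isDiffuseSetFunction_iff] at h ⊢
    exact ⟨IsSignedMeasureSetFunction.isRestrictionStable.congr h.1 e,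
      fun A hA h0 => by rw [← e A hA]; exact h.2 A hA h0⟩
  zero := isDiffuseSetFunction_iff.2
    ⟨IsSignedMeasureSetFunction.isRestrictionStable.zero, fun _ _ _ => rfl⟩
  add h h' := by
    rw [isDiffuseSetFunction_iff] at h h' ⊢
    exact ⟨IsSignedMeasureSetFunction.isRestrictionStable.add h.1 h'.1,
      fun A hA h0 => by simp [h.2 A hA h0, h'.2 A hA h0]⟩
  smul c h := by
    rw [isDiffuseSetFunction_iff] at h ⊢
    exact ⟨IsSignedMeasureSetFunction.isRestrictionStable.smul c h.1,
      fun A hA h0 => by simp [h.2 A hA h0]⟩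
  inter h E hE := by
    rw [isDiffuseSetFunction_iff] at h ⊢
    exact ⟨IsSignedMeasureSetFunction.isRestrictionStable.inter h.1 hE,
      fun A hA h0 => h.2 _ (hA.inter hE) ((measure_mono Set.inter_subset_left).trans_lt h0)⟩

/-- Cut along the σ-finite carrier: diffuseness kills the part inside, concentration the part
outside. -/
theorem IsAbsolutelyContinuousSetFunction.eq_zero_of_isDiffuse {μ : Measure Ω} {ν : Set Ω → ℝ}
    (h : IsAbsolutelyContinuousSetFunction μ ν) (h' : IsDiffuseSetFunction μ ν) {A : Set Ω}
    (hA : MeasurableSet A) : ν A = 0 := by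
  obtain ⟨⟨s, hs⟩, -, S, hS, hz⟩ := isAbsolutelyContinuousSetFunction_iff.1 h
  have hb : IsBoundedAdditive ν :=
    (IsBoundedAdditive.signedMeasure s).congr fun A hA => (hs A hA).symm
  rw [← hb.map_inter_add_sdiff hA hS.measurableSet,
    h'.eq_zero_of_subset hS (hA.inter hS.measurableSet) Set.inter_subset_right,
    hz _ (hA.diff hS.measurableSet) fun _ h => h.2, add_zero]

/-- Apply singularity with the variation of the signed measure itself as test measure. -/
theorem IsSignedMeasureSetFunction.eq_zero_of_isPurelyFinitelyAdditive {ν : Set Ω → ℝ}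
    (h : IsSignedMeasureSetFunction ν) (h' : IsPurelyFinitelyAdditive ν) {A : Set Ω}
    (hA : MeasurableSet A) : ν A = 0 := by
  obtain ⟨hb, hsing⟩ := isPurelyFinitelyAdditive_iff.1 h'
  obtain ⟨s, hs⟩ := h
  have hfin : IsFiniteMeasure s.totalVariation := inferInstance
  rw [← abs_nonpos_iff]
  refine le_of_forall_pos_le_add fun ε hε => ?_
  obtain ⟨C, hC, h1, h2⟩ := hsing s.totalVariation (ε / 2) (half_pos hε)
  rw [← hb.map_inter_add_sdiff hA hC]
  have h3 : |ν (A ∩ C)| ≤ ε / 2 := by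
    rw [hs _ (hA.inter hC)]
    exact (s.abs_le_totalVariation_of_subset Set.inter_subset_right).trans h1
  have h4 := h2 (A \ C) (hA.diff hC) fun _ h => h.2
  refine (abs_add_le _ _).trans ?_
  linarith

/-- A signed measure vanishing on `μ`-null sets is the sum of an absolutely continuous and a diffuse
one. -/
theorem IsSignedMeasureSetFunction.exists_isAbsolutelyContinuous_add_isDiffuse {μ : Measure Ω}
    {ν : Set Ω → ℝ} (h : IsSignedMeasureSetFunction ν)
    (h0 : ∀ A, MeasurableSet A → μ A = 0 → ν A = 0) :
    ∃ S, MeasurableSet S ∧ IsAbsolutelyContinuousSetFunction μ (fun A => ν (A ∩ S)) ∧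
      IsDiffuseSetFunction μ (fun A => ν (A ∩ Sᶜ)) := by
  have h' := h
  obtain ⟨s, hs⟩ := h
  -- This set is maximal among μ-σ-finite sets as seen by the variation of s: any set outside it
  -- with nonzero variation has infinite μ-measure, which is exactly diffuseness off S.
  have hS := isSigmaFiniteSet_sigmaFiniteSetWRT μ s.totalVariation
  have hSm := hS.measurableSet
  refine ⟨_, hSm, isAbsolutelyContinuousSetFunction_iff.2
    ⟨isRestrictionStable.inter h' hSm, fun A hA hA0 => ?_, _, hS, fun A hA hAS => ?_⟩,
    isDiffuseSetFunction_iff.2 ⟨isRestrictionStable.inter h' hSm.compl, fun A hA hf => ?_⟩⟩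
  · exact h0 _ (hA.inter hSm) (measure_mono_null Set.inter_subset_left hA0)
  · rw [(Set.disjoint_iff_inter_eq_empty.1 (Set.subset_compl_iff_disjoint_right.1 hAS) :
      A ∩ _ = ∅), hs _ .empty, VectorMeasure.empty]
  · rw [hs _ (hA.inter hSm.compl)]
    refine s.null_of_totalVariation_zero ?_
    by_contra hne
    have := measure_eq_top_of_subset_compl_sigmaFiniteSetWRT (μ := μ)
      (s := A ∩ (μ.sigmaFiniteSetWRT s.totalVariation)ᶜ) Set.inter_subset_right hne
    exact ((measure_mono Set.inter_subset_left).trans_lt hf).ne this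

end SetFunctionClasses

theorem isInternal_of_forall_exists_add_add {R M : Type*} [Ring R] [AddCommGroup M] [Module R M]
    (A D F : Submodule R M) (hex : ∀ x, ∃ a ∈ A, ∃ d ∈ D, ∃ f ∈ F, x = a + d + f)
    (hz : ∀ a ∈ A, ∀ d ∈ D, ∀ f ∈ F, a + d + f = 0 → a = 0 ∧ d = 0 ∧ f = 0) :
    DirectSum.IsInternal ![A, D, F] := by
  rw [DirectSum.isInternal_submodule_iff_iSupIndep_and_iSup_eq_top]
  constructor
  · rw [iSupIndep_iff_finsetSum_eq_zero_imp_eq_zero]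
    intro s v hv hs
    have h : ∀ i, (if i ∈ s then v i else 0) ∈ ![A, D, F] i := fun i => by
      split_ifs with hi
      · exact hv i hi
      · exact Submodule.zero_mem _
    have hsum : ∑ i, (if i ∈ s then v i else 0) = 0 := by
      rw [Finset.sum_ite_mem, Finset.univ_inter, hs]
    rw [Fin.sum_univ_three] at hsum
    obtain ⟨h0, h1, h2⟩ := hz _ (h 0) _ (h 1) _ (h 2) hsum
    intro i hi
    have : (if i ∈ s then v i else 0) = 0 := by
      fin_cases i
      · exact h0
      · exact h1
      · exact h2
    rwa [if_pos hi] at this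
  · rw [eq_top_iff]
    intro x _
    obtain ⟨a, ha, d, hd, f, hf, rfl⟩ := hex x
    refine add_mem (add_mem ?_ ?_) ?_
    · exact Submodule.mem_iSup_of_mem (p := ![A, D, F]) 0 ha
    · exact Submodule.mem_iSup_of_mem (p := ![A, D, F]) 1 hd
    · exact Submodule.mem_iSup_of_mem (p := ![A, D, F]) 2 hf

/-! ### Lifting the decomposition from set functions to functionals -/

namespace OrliczIntegrand

variable {Ω : Type*} [MeasurableSpace Ω] {μ : Measure Ω}
  {X : Type*} [NormedAddCommGroup X] [NormedSpace ℝ X] [MeasurableSpace X] [BorelSpace X]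
  (φ : OrliczIntegrand μ X)

theorem coeFn_mulIndicator (u : φ.space) {A : Set Ω} (hA : MeasurableSet A) :
    ((φ.mulIndicator u A hA : φ.space) : Ω →ₘ[μ] X) =ᵐ[μ] A.indicator (u : Ω →ₘ[μ] X) :=
  AEEqFun.coeFn_mk _ _

variable {φ} in
theorem space_ext {u v : φ.space} (h : (u : Ω →ₘ[μ] X) =ᵐ[μ] (v : Ω →ₘ[μ] X)) : u = v :=
  Subtype.ext (AEEqFun.ext h)

theorem mulIndicator_add (u v : φ.space) {A : Set Ω} (hA : MeasurableSet A) :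
    φ.mulIndicator (u + v) A hA = φ.mulIndicator u A hA + φ.mulIndicator v A hA := by
  apply space_ext
  rw [Submodule.coe_add]
  filter_upwards [φ.coeFn_mulIndicator (u + v) hA, φ.coeFn_mulIndicator u hA,
    φ.coeFn_mulIndicator v hA, AEEqFun.coeFn_add (u : Ω →ₘ[μ] X) v,
    AEEqFun.coeFn_add (φ.mulIndicator u A hA : Ω →ₘ[μ] X) (φ.mulIndicator v A hA)]
    with ω h1 h2 h3 h4 h5
  rw [h1, h5, Pi.add_apply, h2, h3, Submodule.coe_add]
  by_cases h : ω ∈ A <;> simp [h, h4]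

theorem mulIndicator_smul (c : ℝ) (u : φ.space) {A : Set Ω} (hA : MeasurableSet A) :
    φ.mulIndicator (c • u) A hA = c • φ.mulIndicator u A hA := by
  apply space_ext
  rw [Submodule.coe_smul]
  filter_upwards [φ.coeFn_mulIndicator (c • u) hA, φ.coeFn_mulIndicator u hA,
    AEEqFun.coeFn_smul c (u : Ω →ₘ[μ] X),
    AEEqFun.coeFn_smul c (φ.mulIndicator u A hA : Ω →ₘ[μ] X)] with ω h1 h2 h4 h5
  rw [h1, h5, Pi.smul_apply, h2, Submodule.coe_smul]
  by_cases h : ω ∈ A <;> simp [h, h4]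

theorem mulIndicator_mulIndicator (u : φ.space) {A B : Set Ω} (hA : MeasurableSet A)
    (hB : MeasurableSet B) :
    φ.mulIndicator (φ.mulIndicator u A hA) B hB = φ.mulIndicator u (B ∩ A) (hB.inter hA) := by
  apply space_ext
  filter_upwards [φ.coeFn_mulIndicator (φ.mulIndicator u A hA) hB, φ.coeFn_mulIndicator u hA,
    φ.coeFn_mulIndicator u (hB.inter hA)] with ω h1 h2 h3
  rw [h1, h3]
  by_cases h : ω ∈ B <;> by_cases h' : ω ∈ A <;> simp [h, h', h2]

theorem mulIndicator_union (u : φ.space) {A B : Set Ω} (hA : MeasurableSet A)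
    (hB : MeasurableSet B) (hd : Disjoint A B) :
    φ.mulIndicator u (A ∪ B) (hA.union hB) = φ.mulIndicator u A hA + φ.mulIndicator u B hB := by
  apply space_ext
  rw [Submodule.coe_add]
  filter_upwards [φ.coeFn_mulIndicator u hA, φ.coeFn_mulIndicator u hB,
    φ.coeFn_mulIndicator u (hA.union hB),
    AEEqFun.coeFn_add (φ.mulIndicator u A hA : Ω →ₘ[μ] X) (φ.mulIndicator u B hB)]
    with ω h1 h2 h3 h4
  rw [h3, h4, Pi.add_apply, h1, h2, Set.indicator_union_of_disjoint hd]

theorem mulIndicator_univ (u : φ.space) : φ.mulIndicator u Set.univ .univ = u := by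
  apply space_ext
  filter_upwards [φ.coeFn_mulIndicator u .univ] with ω h
  rw [h, Set.indicator_univ]

theorem mulIndicator_of_measure_zero (u : φ.space) {A : Set Ω} (hA : MeasurableSet A)
    (h0 : μ A = 0) : φ.mulIndicator u A hA = 0 := by
  apply space_ext
  rw [Submodule.coe_zero]
  filter_upwards [φ.coeFn_mulIndicator u hA, measure_eq_zero_iff_ae_notMem.1 h0,
    AEEqFun.coeFn_zero (α := Ω) (β := X) (μ := μ)] with ω h1 h2 h3
  rw [h1, h3, Set.indicator_of_notMem h2, Pi.zero_apply]

theorem norm_mulIndicator_le (u : φ.space) {A : Set Ω} (hA : MeasurableSet A) :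
    ‖φ.mulIndicator u A hA‖ ≤ ‖u‖ := by
  refine csInf_le_csInf (φ.scalings_bddBelow _) u.2 fun α hα => ⟨hα.1, le_trans ?_ hα.2⟩
  refine φ.modular_mono ?_
  filter_upwards [φ.ae_isOrliczFunction, φ.coeFn_mulIndicator u hA] with ω hω h
  rw [h]
  by_cases h : ω ∈ A
  · rw [Set.indicator_of_mem h]
  · rw [Set.indicator_of_notMem h, smul_zero, hω.map_zero]
    exact zero_le

variable (ℓ ℓ' : φ.space →L[ℝ] ℝ) (u v : φ.space) {A : Set Ω}

theorem setFunction_apply (hA : MeasurableSet A) :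
    φ.setFunction ℓ u A = ℓ (φ.mulIndicator u A hA) := dif_pos hA

theorem setFunction_univ : φ.setFunction ℓ u Set.univ = ℓ u := by
  rw [φ.setFunction_apply ℓ u .univ, φ.mulIndicator_univ]

theorem abs_setFunction_le (hA : MeasurableSet A) : |φ.setFunction ℓ u A| ≤ ‖ℓ‖ * ‖u‖ := by
  rw [φ.setFunction_apply ℓ u hA]
  exact (ℓ.le_opNorm _).trans
    (mul_le_mul_of_nonneg_left (φ.norm_mulIndicator_le u hA) (norm_nonneg _))

theorem isBoundedAdditive_setFunction : IsBoundedAdditive (φ.setFunction ℓ u) := by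
  refine ⟨fun A B hA hB hd => ?_, ‖ℓ‖ * ‖u‖, fun A hA => φ.abs_setFunction_le ℓ u hA⟩
  rw [φ.setFunction_apply ℓ u hA, φ.setFunction_apply ℓ u hB,
    φ.setFunction_apply ℓ u (hA.union hB), φ.mulIndicator_union u hA hB hd, map_add]

theorem setFunction_add_left :
    φ.setFunction (ℓ + ℓ') u = φ.setFunction ℓ u + φ.setFunction ℓ' u := by
  ext A
  by_cases hA : MeasurableSet A <;> simp [setFunction, hA]

theorem setFunction_smul_left (c : ℝ) : φ.setFunction (c • ℓ) u = c • φ.setFunction ℓ u := by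
  ext A
  by_cases hA : MeasurableSet A <;> simp [setFunction, hA]

theorem setFunction_zero_left : φ.setFunction 0 u = 0 := by
  ext A
  by_cases hA : MeasurableSet A <;> simp [setFunction, hA]

theorem setFunction_add_right :
    φ.setFunction ℓ (u + v) = φ.setFunction ℓ u + φ.setFunction ℓ v := by
  ext A
  by_cases hA : MeasurableSet A <;> simp [setFunction, hA, mulIndicator_add]

theorem setFunction_smul_right (c : ℝ) : φ.setFunction ℓ (c • u) = c • φ.setFunction ℓ u := by
  ext A
  by_cases hA : MeasurableSet A <;> simp [setFunction, hA, mulIndicator_smul]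

theorem setFunction_mulIndicator {E : Set Ω} (hE : MeasurableSet E) (hA : MeasurableSet A) :
    φ.setFunction ℓ (φ.mulIndicator u E hE) A = φ.setFunction ℓ u (A ∩ E) := by
  rw [φ.setFunction_apply _ _ hA, φ.setFunction_apply _ _ (hA.inter hE),
    φ.mulIndicator_mulIndicator]

/-- This is why no component carried by a μ-null set appears in the decomposition. -/
theorem setFunction_of_measure_zero (hA : MeasurableSet A) (h0 : μ A = 0) :
    φ.setFunction ℓ u A = 0 := by
  rw [φ.setFunction_apply _ _ hA, φ.mulIndicator_of_measure_zero u hA h0, map_zero]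

/-- The functionals all of whose set functions belong to a given class. -/
def functionalsOf {P : (Set Ω → ℝ) → Prop} (hP : IsRestrictionStable P) :
    Submodule ℝ (φ.space →L[ℝ] ℝ) where
  carrier := {ℓ | ∀ u, P (φ.setFunction ℓ u)}
  zero_mem' u := by
    rw [setFunction_zero_left]
    exact hP.zero
  add_mem' h h' u := by
    rw [setFunction_add_left]
    exact hP.add (h u) (h' u)
  smul_mem' c ℓ h u := by
    rw [setFunction_smul_left]
    exact hP.smul c (h u)

variable {ℓ ℓ'}

/-- A pointwise decomposition of the set functions of a functional into two independent classes
comes from a decomposition of the functional. -/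
theorem exists_add_mem_functionalsOf {P Q : (Set Ω → ℝ) → Prop} (hP : IsRestrictionStable P)
    (hQ : IsRestrictionStable Q)
    (hPQ : ∀ ν, P ν → Q ν → ∀ A, MeasurableSet A → ν A = 0)
    (h : ∀ u, ∃ p, P p ∧ Q (φ.setFunction ℓ u - p) ∧ |p Set.univ| ≤ ‖ℓ‖ * ‖u‖) :
    ∃ ℓp ∈ φ.functionalsOf hP, ∃ ℓq ∈ φ.functionalsOf hQ, ℓ = ℓp + ℓq := by
  choose p hp hq hbound using h
  -- Two P-parts of the same set function differ by an element of both classes, hence agree on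
  -- measurable sets. The chosen `p u` is therefore canonical, and linearity in `u` follows by
  -- comparing candidates.
  have huniq : ∀ u p', P p' → Q (φ.setFunction ℓ u - p') → ∀ A, MeasurableSet A →
      p u A = p' A := by
    intro u p' hp' hq' A hA
    have h1 : P (p u + (-1 : ℝ) • p') := hP.add (hp u) (hP.smul _ hp')
    have h2 : Q (p u + (-1 : ℝ) • p') := by
      refine hQ.congr (hQ.add hq' (hQ.smul (-1 : ℝ) (hq u))) fun B _ => ?_
      simp only [Pi.add_apply, Pi.smul_apply, Pi.sub_apply, smul_eq_mul]
      ring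
    have := hPQ _ h1 h2 A hA
    simp only [Pi.add_apply, Pi.smul_apply, smul_eq_mul] at this
    linarith
  have hadd : ∀ u v, p (u + v) Set.univ = p u Set.univ + p v Set.univ := fun u v => by
    refine huniq (u + v) (p u + p v) (hP.add (hp u) (hp v)) ?_ _ .univ
    rw [setFunction_add_right, add_sub_add_comm]
    exact hQ.add (hq u) (hq v)
  have hsmul : ∀ (c : ℝ) u, p (c • u) Set.univ = c * p u Set.univ := fun c u => by
    refine huniq (c • u) (c • p u) (hP.smul c (hp u)) ?_ _ .univ
    rw [setFunction_smul_right, ← smul_sub]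
    exact hQ.smul c (hq u)
  let ℓp : φ.space →L[ℝ] ℝ := LinearMap.mkContinuous
    { toFun := fun u => p u Set.univ
      map_add' := hadd
      map_smul' := hsmul } ‖ℓ‖ hbound
  -- Restricting the decomposition for `u` to A decomposes the set function of `u χ_A`; by
  -- uniqueness the P-part of the latter has total value `p u A`.
  have hℓp : ∀ u A, MeasurableSet A → p u A = φ.setFunction ℓp u A := by
    intro u A hA
    rw [φ.setFunction_apply _ _ hA]
    change p u A = p (φ.mulIndicator u A hA) Set.univ
    rw [huniq (φ.mulIndicator u A hA) (fun B => p u (B ∩ A)) (hP.inter (hp u) hA) ?_ _ .univ,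
      Set.univ_inter]
    refine hQ.congr (hQ.inter (hq u) hA) fun B hB => ?_
    simp only [Pi.sub_apply]
    rw [φ.setFunction_mulIndicator ℓ u hA hB]
  refine ⟨ℓp, fun u => hP.congr (hp u) (hℓp u), ℓ - ℓp, fun u => hQ.congr (hq u) fun A hA => ?_,
    (add_sub_cancel _ _).symm⟩
  rw [Pi.sub_apply, hℓp u A hA, φ.setFunction_apply _ _ hA, φ.setFunction_apply _ _ hA,
    φ.setFunction_apply _ _ hA, sub_apply]

theorem eq_zero_of_mem_functionalsOf {P Q : (Set Ω → ℝ) → Prop} {hP : IsRestrictionStable P}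
    {hQ : IsRestrictionStable Q} (hPQ : ∀ ν, P ν → Q ν → ∀ A, MeasurableSet A → ν A = 0)
    (h : ℓ ∈ φ.functionalsOf hP) (h' : ℓ ∈ φ.functionalsOf hQ) : ℓ = 0 := by
  ext u
  rw [← φ.setFunction_univ ℓ u, hPQ _ (h u) (h' u) _ .univ, zero_apply]

theorem exists_signedMeasure_add_purelyFinitelyAdditive (ℓ : φ.space →L[ℝ] ℝ) :
    ∃ ℓc ∈ φ.functionalsOf IsSignedMeasureSetFunction.isRestrictionStable,
      ∃ ℓf ∈ φ.functionalsOf IsPurelyFinitelyAdditive.isRestrictionStable, ℓ = ℓc + ℓf := by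
  refine φ.exists_add_mem_functionalsOf _ _
    (fun ν h h' A hA => h.eq_zero_of_isPurelyFinitelyAdditive h' hA) fun u => ?_
  have hb := φ.isBoundedAdditive_setFunction ℓ u
  obtain ⟨s, hs, hC⟩ := hb.exists_signedMeasure_add_isSingular
    fun A hA => φ.abs_setFunction_le ℓ u hA
  exact ⟨s, ⟨s, fun _ _ => rfl⟩, isPurelyFinitelyAdditive_iff.2
    ⟨hb.sub (IsBoundedAdditive.signedMeasure s), hs⟩, hC⟩

theorem exists_absolutelyContinuous_add_diffuse
    (hℓ : ℓ ∈ φ.functionalsOf IsSignedMeasureSetFunction.isRestrictionStable) :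
    ∃ ℓa ∈ φ.functionalsOf (IsAbsolutelyContinuousSetFunction.isRestrictionStable μ),
      ∃ ℓd ∈ φ.functionalsOf (IsDiffuseSetFunction.isRestrictionStable μ), ℓ = ℓa + ℓd := by
  refine φ.exists_add_mem_functionalsOf _ _
    (fun ν h h' A hA => h.eq_zero_of_isDiffuse h' hA) fun u => ?_
  obtain ⟨S, hS, ha, hd⟩ := (hℓ u).exists_isAbsolutelyContinuous_add_isDiffuse (μ := μ)
    fun A hA h0 => φ.setFunction_of_measure_zero ℓ u hA h0
  refine ⟨_, ha, (IsDiffuseSetFunction.isRestrictionStable μ).congr hd fun A hA => ?_, ?_⟩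
  · have := (φ.isBoundedAdditive_setFunction ℓ u).map_inter_add_sdiff hA hS
    rw [Set.sdiff_eq] at this
    rw [Pi.sub_apply]
    linarith
  -- The total value of the absolutely continuous part is the value of the original set function at
  -- S.
  · rw [Set.univ_inter]
    exact φ.abs_setFunction_le ℓ u hS

theorem exists_decomposition (ℓ : φ.space →L[ℝ] ℝ) :
    ∃ ℓa ∈ φ.acFunctionals, ∃ ℓd ∈ φ.diffuseFunctionals, ∃ ℓf ∈ φ.pfaFunctionals,
      ℓ = ℓa + ℓd + ℓf := by
  obtain ⟨ℓc, hc, ℓf, hf, rfl⟩ := φ.exists_signedMeasure_add_purelyFinitelyAdditive ℓ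
  obtain ⟨ℓa, ha, ℓd, hd, rfl⟩ := φ.exists_absolutelyContinuous_add_diffuse hc
  exact ⟨ℓa, ha, ℓd, hd, ℓf, hf, rfl⟩

/-- The sum ℓa + ℓd = -ℓf is both countably and purely finitely additive, hence zero; then ℓa = -ℓd
is both absolutely continuous and diffuse. -/
theorem eq_zero_of_add_add_eq_zero {ℓa ℓd ℓf : φ.space →L[ℝ] ℝ} (ha : ℓa ∈ φ.acFunctionals)
    (hd : ℓd ∈ φ.diffuseFunctionals) (hf : ℓf ∈ φ.pfaFunctionals) (h : ℓa + ℓd + ℓf = 0) :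
    ℓa = 0 ∧ ℓd = 0 ∧ ℓf = 0 := by
  have hc : ℓa + ℓd ∈ φ.functionalsOf IsSignedMeasureSetFunction.isRestrictionStable :=
    add_mem (fun u => (isAbsolutelyContinuousSetFunction_iff.1 (ha u)).1)
      fun u => (isDiffuseSetFunction_iff.1 (hd u)).1
  have hcf : ℓa + ℓd ∈ φ.functionalsOf IsPurelyFinitelyAdditive.isRestrictionStable := by
    rw [eq_neg_of_add_eq_zero_left h]
    exact neg_mem (S := Submodule ℝ (φ.space →L[ℝ] ℝ)) hf
  have h1 : ℓa + ℓd = 0 := φ.eq_zero_of_mem_functionalsOf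
    (fun ν h h' A hA => h.eq_zero_of_isPurelyFinitelyAdditive h' hA) hc hcf
  have had : ℓa ∈ φ.functionalsOf (IsDiffuseSetFunction.isRestrictionStable μ) := by
    rw [eq_neg_of_add_eq_zero_left h1]
    exact neg_mem (S := Submodule ℝ (φ.space →L[ℝ] ℝ)) hd
  have h2 : ℓa = 0 := φ.eq_zero_of_mem_functionalsOf
    (hP := IsAbsolutelyContinuousSetFunction.isRestrictionStable μ)
    (fun ν h h' A hA => h.eq_zero_of_isDiffuse h' hA) ha had
  refine ⟨h2, ?_, ?_⟩
  · rwa [h2, zero_add] at h1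
  · rwa [h1, zero_add] at h

end OrliczIntegrand

/-! ### Where a finite exhausting integral lives -/

section ExhaustingIntegral

variable {Ω : Type*} [MeasurableSpace Ω] {μ : Measure Ω} {f g : Ω → ℝ≥0∞}

theorem IsAtomSigmaFiniteSet.empty : IsAtomSigmaFiniteSet μ ∅ :=
  ⟨fun _ => ∅, fun _ => Or.inr ⟨.empty, by simp⟩, by simp⟩

theorem IsAtomSigmaFiniteSet.iUnion {A : ℕ → Set Ω} (h : ∀ n, IsAtomSigmaFiniteSet μ (A n)) :
    IsAtomSigmaFiniteSet μ (⋃ n, A n) := by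
  choose B hB hAB using h
  refine ⟨fun k => B k.unpair.1 k.unpair.2, fun k => hB _ _, ?_⟩
  rw [Set.iUnion_unpair fun m n => B m n]
  exact Set.iUnion_congr hAB

theorem IsAtomSigmaFiniteSet.union {A B : Set Ω} (hA : IsAtomSigmaFiniteSet μ A)
    (hB : IsAtomSigmaFiniteSet μ B) : IsAtomSigmaFiniteSet μ (A ∪ B) := by
  have : A ∪ B = ⋃ n : ℕ, if n = 0 then A else B := by
    ext ω
    simp only [Set.mem_union, Set.mem_iUnion]
    constructor
    · rintro (h | h)
      · exact ⟨0, by simpa using h⟩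
      · exact ⟨1, by simpa using h⟩
    · rintro ⟨n, hn⟩
      split_ifs at hn
      · exact Or.inl hn
      · exact Or.inr hn
  rw [this]
  refine .iUnion fun n => ?_
  split_ifs
  · exact hA
  · exact hB

theorem setLIntegral_le_exhaustingIntegral {A : Set Ω} (hA : IsAtomSigmaFiniteSet μ A) :
    ∫⁻ ω in A, f ω ∂μ ≤ exhaustingIntegral μ f :=
  le_iSup₂ (f := fun (A : Set Ω) (_ : IsAtomSigmaFiniteSet μ A) => ∫⁻ ω in A, f ω ∂μ) A hA

theorem exhaustingIntegral_mono (h : f ≤ᵐ[μ] g) :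
    exhaustingIntegral μ f ≤ exhaustingIntegral μ g :=
  iSup₂_mono fun _ _ => lintegral_mono_ae (ae_restrict_of_ae h)

theorem exhaustingIntegral_const_mul_le (c : ℝ≥0∞) (hc : c ≠ ∞) :
    exhaustingIntegral μ (fun ω => c * f ω) ≤ c * exhaustingIntegral μ f := by
  refine iSup₂_le fun A hA => ?_
  rw [lintegral_const_mul' _ _ hc]
  gcongr
  exact setLIntegral_le_exhaustingIntegral hA

theorem exhaustingIntegral_add_le
    (hf : ∀ A, IsAtomSigmaFiniteSet μ A → AEMeasurable f (μ.restrict A)) :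
    exhaustingIntegral μ (f + g) ≤ exhaustingIntegral μ f + exhaustingIntegral μ g := by
  refine iSup₂_le fun A hA => ?_
  simp only [Pi.add_apply]
  rw [lintegral_add_left' (hf A hA)]
  exact add_le_add (setLIntegral_le_exhaustingIntegral hA) (setLIntegral_le_exhaustingIntegral hA)

/-- The exhausting integral is attained. -/
theorem exists_setLIntegral_eq_exhaustingIntegral (μ : Measure Ω) (f : Ω → ℝ≥0∞) :
    ∃ A, IsAtomSigmaFiniteSet μ A ∧ ∫⁻ ω in A, f ω ∂μ = exhaustingIntegral μ f := by
  rcases eq_or_ne (exhaustingIntegral μ f) 0 with h0 | h0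
  · exact ⟨∅, .empty, by simp [h0]⟩
  -- The admissible sets are closed under countable unions, so the union of a maximizing sequence
  -- attains the supremum.
  obtain ⟨c, -, hc, hlim⟩ := exists_seq_strictMono_tendsto' (pos_iff_ne_zero.2 h0)
  have : ∀ n, ∃ A, IsAtomSigmaFiniteSet μ A ∧ c n < ∫⁻ ω in A, f ω ∂μ := fun n => by
    have := (hc n).2
    simpa only [exhaustingIntegral, lt_iSup_iff, exists_prop] using this
  choose A hA hcA using this
  refine ⟨⋃ n, A n, .iUnion hA,
    le_antisymm (setLIntegral_le_exhaustingIntegral (.iUnion hA)) ?_⟩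
  exact le_of_tendsto' hlim fun n =>
    (hcA n).le.trans (lintegral_mono_set (Set.subset_iUnion A n))

/-- A finite exhausting integral is carried by one countable union of atoms and sets of finite
measure. -/
theorem exists_exhaustingIntegral_indicator_le (hf : exhaustingIntegral μ f ≠ ∞) :
    ∃ A, IsAtomSigmaFiniteSet μ A ∧ ∫⁻ ω in A, f ω ∂μ ≠ ∞ ∧ ∀ E, MeasurableSet E →
      exhaustingIntegral μ (E.indicator f) ≤ ∫⁻ ω in A ∩ E, f ω ∂μ := by
  obtain ⟨A, hA, hAf⟩ := exists_setLIntegral_eq_exhaustingIntegral μ f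
  refine ⟨A, hA, hAf ▸ hf, fun E hE => iSup₂_le fun B hB => ?_⟩
  have hAm := hA.measurableSet
  have hBm := hB.measurableSet
  -- A attains the finite supremum and A ∪ B is still admissible, so nothing is left to gain on B \
  -- A.
  have h0 : ∫⁻ ω in B \ A, f ω ∂μ = 0 := by
    have h1 := setLIntegral_le_exhaustingIntegral (f := f) (hA.union hB)
    rw [← Set.union_sdiff_self, lintegral_union (hBm.diff hAm) Set.disjoint_sdiff_right, hAf] at h1
    have h2 : exhaustingIntegral μ f + ∫⁻ ω in B \ A, f ω ∂μ ≤ exhaustingIntegral μ f + 0 := by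
      rwa [add_zero]
    exact nonpos_iff_eq_zero.1 ((ENNReal.add_le_add_iff_left hf).1 h2)
  rw [lintegral_indicator hE, Measure.restrict_restrict hE]
  calc ∫⁻ ω in E ∩ B, f ω ∂μ ≤ ∫⁻ ω in A ∩ E ∪ B \ A, f ω ∂μ := by
        refine lintegral_mono_set fun ω hω => ?_
        by_cases h : ω ∈ A
        · exact Or.inl ⟨h, hω.1⟩
        · exact Or.inr ⟨hω.2, h⟩
    _ ≤ ∫⁻ ω in A ∩ E, f ω ∂μ + ∫⁻ ω in B \ A, f ω ∂μ := lintegral_union_le _ _ _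
    _ = ∫⁻ ω in A ∩ E, f ω ∂μ := by rw [h0, add_zero]

/-- The measure with density f on the attaining set. It lets the modular of a function enter the
list of finite measures that a singular set function can be tested against. -/
theorem exists_measure_exhaustingIntegral_indicator_le (hf : exhaustingIntegral μ f ≠ ∞) :
    ∃ m : Measure Ω, IsFiniteMeasure m ∧ ∀ E, MeasurableSet E →
      exhaustingIntegral μ (E.indicator f) ≤ m E := by
  obtain ⟨A, hA, hfin, hE⟩ := exists_exhaustingIntegral_indicator_le hf
  refine ⟨(μ.restrict A).withDensity f, isFiniteMeasure_withDensity hfin, fun E hEm => ?_⟩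
  rw [withDensity_apply _ hEm, Measure.restrict_restrict hEm, Set.inter_comm]
  exact hE E hEm

/-- By Markov's inequality the sets {f ≥ 1/(n+1)} inside the attaining set have finite measure, even
if that set contains atoms of infinite measure; off their union f contributes nothing. -/
theorem exists_isSigmaFiniteSet_exhaustingIntegral_indicator_eq_zero
    (hm : ∀ A, IsAtomSigmaFiniteSet μ A → AEMeasurable f (μ.restrict A))
    (hf : exhaustingIntegral μ f ≠ ∞) :
    ∃ S, IsSigmaFiniteSet μ S ∧ ∀ E, MeasurableSet E → E ⊆ Sᶜ →
      exhaustingIntegral μ (E.indicator f) = 0 := by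
  obtain ⟨A, hA, hfin, hE⟩ := exists_exhaustingIntegral_indicator_le hf
  have hAm := hA.measurableSet
  have hgm := (hm A hA).measurable_mk
  set g := (hm A hA).mk f
  have hfg : f =ᵐ[μ.restrict A] g := (hm A hA).ae_eq_mk
  have hgm' : ∀ n : ℕ, MeasurableSet {ω | ((n : ℝ≥0∞) + 1)⁻¹ ≤ g ω} := fun n =>
    measurableSet_le measurable_const hgm
  refine ⟨⋃ n : ℕ, A ∩ {ω | ((n : ℝ≥0∞) + 1)⁻¹ ≤ g ω},
    ⟨_, fun n => ⟨hAm.inter (hgm' n), ?_⟩, rfl⟩, fun E hEm hES => ?_⟩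
  · have h1 := meas_ge_le_lintegral_div (μ := μ.restrict A) hgm.aemeasurable
      (ε := ((n : ℝ≥0∞) + 1)⁻¹) (by simp) (by simp)
    rw [Measure.restrict_apply (hgm' n), Set.inter_comm] at h1
    refine h1.trans_lt (ENNReal.div_lt_top ?_ (by simp))
    rwa [← lintegral_congr_ae hfg]
  · refine nonpos_iff_eq_zero.1 ((hE E hEm).trans (le_of_eq ?_))
    have hfg' : ∀ᵐ ω ∂(μ.restrict (A ∩ E)), f ω = 0 := by
      filter_upwards [ae_restrict_of_ae_restrict_of_subset Set.inter_subset_left hfg,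
        ae_restrict_mem (hAm.inter hEm)] with ω h1 h2
      by_contra hne
      rw [h1] at hne
      obtain ⟨n, hn⟩ := ENNReal.exists_inv_nat_lt hne
      refine hES h2.2 (Set.mem_iUnion.2 ⟨n, h2.1, le_trans ?_ hn.le⟩)
      exact ENNReal.inv_le_inv.2 le_self_add
    rw [lintegral_congr_ae hfg', lintegral_zero]

end ExhaustingIntegral

/-! ### Additivity of the dual norm -/

namespace OrliczIntegrand

variable {Ω : Type*} [MeasurableSpace Ω] {μ : Measure Ω}
  {X : Type*} [NormedAddCommGroup X] [NormedSpace ℝ X] [MeasurableSpace X] [BorelSpace X]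
  (φ : OrliczIntegrand μ X)

/-- Strict inequality yields an admissible scaling below 1 directly, without knowing that the
infimum in the Luxemburg norm is attained. -/
theorem modular_le_one_of_norm_lt_one {u : φ.space} (h : ‖u‖ < 1) :
    φ.modular (u : Ω →ₘ[μ] X) ≤ 1 := by
  obtain ⟨α, hα, hlt⟩ := exists_lt_of_csInf_lt u.2 h
  have := (φ.scalings_smul 1 hα one_pos (by simpa using hlt.le)).2
  simpa using this

/-- Convexity and φ(ω, 0) = 0 give I(u/c) ≤ I(u)/c for c ≥ 1. This turns a modular bound 1 + ε into
a norm bound 1 + ε. -/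
theorem norm_le_of_modular_le {u : φ.space} {c : ℝ} (hc : 1 ≤ c)
    (h : φ.modular (u : Ω →ₘ[μ] X) ≤ ENNReal.ofReal c) : ‖u‖ ≤ c := by
  have hc0 : 0 < c := one_pos.trans_le hc
  obtain ⟨t, ht⟩ : ∃ t : ℝ≥0, (t : ℝ) = c⁻¹ := ⟨⟨c⁻¹, by positivity⟩, rfl⟩
  refine csInf_le (φ.scalings_bddBelow _) ⟨hc0, ?_⟩
  have h1 : φ.modular (fun ω => c⁻¹ • (u : Ω →ₘ[μ] X) ω) ≤ t * φ.modular (u : Ω →ₘ[μ] X) := by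
    refine (exhaustingIntegral_mono ?_).trans
      (exhaustingIntegral_const_mul_le (t : ℝ≥0∞) ENNReal.coe_ne_top)
    filter_upwards [φ.ae_isOrliczFunction] with ω hω
    rw [← ht]
    refine hω.map_smul_le t ?_ _
    rw [← NNReal.coe_le_coe, ht]
    exact inv_le_one_of_one_le₀ hc
  refine h1.trans ((mul_le_mul_right h _).trans (le_of_eq ?_))
  rw [← ENNReal.ofReal_coe_nnreal, ht, ← ENNReal.ofReal_mul (by positivity),
    inv_mul_cancel₀ hc0.ne', ENNReal.ofReal_one]

theorem aemeasurable_comp_space (u : φ.space) {A : Set Ω} (hA : IsAtomSigmaFiniteSet μ A) :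
    AEMeasurable (fun ω => φ.toFun ω ((u : Ω →ₘ[μ] X) ω)) (μ.restrict A) :=
  φ.aemeasurable_comp (u : Ω →ₘ[μ] X).aestronglyMeasurable hA

/-- The modular of a function pieced together from three elements of the space. -/
theorem modular_mulIndicator_add_add_le (u v w : φ.space) {S T C : Set Ω} (hS : MeasurableSet S)
    (hT : MeasurableSet T) (hC : MeasurableSet C) (hST : Disjoint S T) (hSC : Disjoint S C)
    (hTC : Disjoint T C) :
    φ.modular ((φ.mulIndicator u S hS + φ.mulIndicator v T hT + φ.mulIndicator w C hC : φ.space) :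
        Ω →ₘ[μ] X) ≤
      exhaustingIntegral μ (S.indicator fun ω => φ.toFun ω ((u : Ω →ₘ[μ] X) ω)) +
      exhaustingIntegral μ (T.indicator fun ω => φ.toFun ω ((v : Ω →ₘ[μ] X) ω)) +
      exhaustingIntegral μ (C.indicator fun ω => φ.toFun ω ((w : Ω →ₘ[μ] X) ω)) := by
  refine le_trans ?_ ((exhaustingIntegral_add_le fun A hA => ?_).trans
    (add_le_add_left (exhaustingIntegral_add_le fun A hA => ?_) _))
  · refine exhaustingIntegral_mono ?_
    rw [Submodule.coe_add, Submodule.coe_add]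
    filter_upwards [φ.ae_isOrliczFunction, φ.coeFn_mulIndicator u hS, φ.coeFn_mulIndicator v hT,
      φ.coeFn_mulIndicator w hC,
      AEEqFun.coeFn_add (φ.mulIndicator u S hS : Ω →ₘ[μ] X) (φ.mulIndicator v T hT),
      AEEqFun.coeFn_add ((φ.mulIndicator u S hS : Ω →ₘ[μ] X) + (φ.mulIndicator v T hT : Ω →ₘ[μ] X))
        (φ.mulIndicator w C hC)] with ω h0 h1 h2 h3 h4 h5
    rw [h5, Pi.add_apply, h4, Pi.add_apply, h1, h2, h3]
    by_cases hωS : ω ∈ S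
    · simp [hωS, hST.notMem_of_mem_left hωS, hSC.notMem_of_mem_left hωS]
    · by_cases hωT : ω ∈ T
      · simp [hωS, hωT, hTC.notMem_of_mem_left hωT]
      · by_cases hωC : ω ∈ C <;> simp [hωS, hωT, hωC, h0.map_zero]
  · exact ((φ.aemeasurable_comp_space u hA).indicator hS).add
      ((φ.aemeasurable_comp_space v hA).indicator hT)
  · exact (φ.aemeasurable_comp_space u hA).indicator hS

theorem exists_norm_lt_one_lt_apply (ℓ : φ.space →L[ℝ] ℝ) {ε : ℝ} (hε : 0 < ε) :
    ∃ u : φ.space, ‖u‖ < 1 ∧ ‖ℓ‖ - ε ≤ ℓ u := by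
  rcases lt_or_ge (‖ℓ‖ - ε) 0 with h | h
  · exact ⟨0, by simp, by simpa using h.le⟩
  · obtain ⟨x, hx, hlt⟩ := ℓ.exists_lt_apply_of_lt_opNorm (r := ‖ℓ‖ - ε) (by linarith)
    rcases abs_choice (ℓ x) with h' | h'
    · exact ⟨x, hx, by rw [Real.norm_eq_abs, h'] at hlt; exact hlt.le⟩
    · exact ⟨-x, by rwa [norm_neg], by rw [Real.norm_eq_abs, h'] at hlt; rw [map_neg]; exact hlt.le⟩

theorem exists_finiteMeasure_abs_setFunction_le {ℓ : φ.space →L[ℝ] ℝ} {u : φ.space}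
    (h : IsSignedMeasureSetFunction (φ.setFunction ℓ u)) :
    ∃ m : Measure Ω, IsFiniteMeasure m ∧ ∀ B C, MeasurableSet B → B ⊆ C →
      |φ.setFunction ℓ u B| ≤ m.real C := by
  obtain ⟨s, hs⟩ := h
  exact ⟨s.totalVariation, inferInstance, fun B C hB hBC => by
    rw [hs B hB]; exact s.abs_le_totalVariation_of_subset hBC⟩

theorem norm_add_add_le {ℓa ℓd ℓf : φ.space →L[ℝ] ℝ} (ha : ℓa ∈ φ.acFunctionals)
    (hd : ℓd ∈ φ.diffuseFunctionals) (hf : ℓf ∈ φ.pfaFunctionals) :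
    ‖ℓa‖ + ‖ℓd‖ + ‖ℓf‖ ≤ ‖ℓa + ℓd + ℓf‖ := by
  -- The ten ε: three from the choice of near-maximizers u, v, w, two from the values of ℓa, two
  -- from those of ℓd and three from those of ℓf on the spliced function.
  suffices key : ∀ ε : ℝ, 0 < ε →
      ‖ℓa‖ + ‖ℓd‖ + ‖ℓf‖ ≤ ‖ℓa + ℓd + ℓf‖ * (1 + ε) + 10 * ε by
    refine le_of_forall_pos_le_add fun δ hδ => ?_
    have hpos : 0 < ‖ℓa + ℓd + ℓf‖ + 10 := by positivity
    refine (key (δ / (‖ℓa + ℓd + ℓf‖ + 10)) (by positivity)).trans (le_of_eq ?_)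
    field_simp
    ring
  intro ε hε
  have hac := fun x => (isAbsolutelyContinuousSetFunction_iff.1 (ha x)).1
  have hdc := fun x => (isDiffuseSetFunction_iff.1 (hd x)).1
  have hfs := fun x => (isPurelyFinitelyAdditive_iff.1 (hf x)).2
  have ba := fun x => φ.isBoundedAdditive_setFunction ℓa x
  have bd := fun x => φ.isBoundedAdditive_setFunction ℓd x
  have bf := fun x => φ.isBoundedAdditive_setFunction ℓf x
  obtain ⟨u, hu, hau⟩ := φ.exists_norm_lt_one_lt_apply ℓa hε
  obtain ⟨v, hv, hdv⟩ := φ.exists_norm_lt_one_lt_apply ℓd hε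
  obtain ⟨w, hw, hfw⟩ := φ.exists_norm_lt_one_lt_apply ℓf hε
  have hv_mod := φ.modular_le_one_of_norm_lt_one hv
  have hw_mod := φ.modular_le_one_of_norm_lt_one hw
  -- a `σ`-finite set carrying the absolutely continuous parts and the modular of `v`
  obtain ⟨-, -, Su, hSu, hSu0⟩ := isAbsolutelyContinuousSetFunction_iff.1 (ha u)
  obtain ⟨-, -, Sv, hSv, hSv0⟩ := isAbsolutelyContinuousSetFunction_iff.1 (ha v)
  -- Off T the function v has zero modular, so it can be placed there at no cost, while ℓd does not
  -- see the σ-finite set that is given up.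
  obtain ⟨T, hT, hT0⟩ := exists_isSigmaFiniteSet_exhaustingIntegral_indicator_eq_zero
    (fun A hA => φ.aemeasurable_comp_space v hA) (ne_top_of_le_ne_top ENNReal.one_ne_top hv_mod)
  obtain ⟨S, hS, hSuS, hSvS, hTS⟩ : ∃ S, IsSigmaFiniteSet μ S ∧ Su ⊆ S ∧ Sv ⊆ S ∧ T ⊆ S :=
    ⟨Su ∪ Sv ∪ T, (hSu.union hSv).union hT,
      Set.subset_union_left.trans Set.subset_union_left,
      Set.subset_union_right.trans Set.subset_union_left, Set.subset_union_right⟩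
  have hSm := hS.measurableSet
  -- a small set carrying the purely finitely additive parts
  obtain ⟨m₁, _, hm₁⟩ := φ.exists_finiteMeasure_abs_setFunction_le (hac u)
  obtain ⟨m₂, _, hm₂⟩ := φ.exists_finiteMeasure_abs_setFunction_le (hac w)
  obtain ⟨m₃, _, hm₃⟩ := φ.exists_finiteMeasure_abs_setFunction_le (hdc v)
  obtain ⟨m₄, _, hm₄⟩ := φ.exists_finiteMeasure_abs_setFunction_le (hdc w)
  obtain ⟨m₅, _, hm₅⟩ := exists_measure_exhaustingIntegral_indicator_le
    (ne_top_of_le_ne_top ENNReal.one_ne_top hw_mod)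
  obtain ⟨C, hC, hCm, hCu, hCv, hCw⟩ : ∃ C, MeasurableSet C ∧
      (m₁.real C ≤ ε ∧ m₂.real C ≤ ε ∧ m₃.real C ≤ ε ∧ m₄.real C ≤ ε ∧ m₅.real C ≤ ε) ∧
      (∀ B, MeasurableSet B → B ⊆ Cᶜ → |φ.setFunction ℓf u B| ≤ ε) ∧
      (∀ B, MeasurableSet B → B ⊆ Cᶜ → |φ.setFunction ℓf v B| ≤ ε) ∧
      ∀ B, MeasurableSet B → B ⊆ Cᶜ → |φ.setFunction ℓf w B| ≤ ε := by
    -- One exceptional set for each of u, v, w, each small for the sum of the five measures; their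
    -- union is C.
    have hε3 : 0 < ε / 3 := by positivity
    have small : ∀ x, ∃ D, MeasurableSet D ∧
        (m₁ + m₂ + m₃ + m₄ + m₅).real D ≤ ε / 3 ∧
        ∀ B, MeasurableSet B → B ⊆ Dᶜ → |φ.setFunction ℓf x B| ≤ ε / 3 :=
      fun x => hfs x _ _ hε3
    obtain ⟨D₁, hD₁, e₁, f₁⟩ := small u
    obtain ⟨D₂, hD₂, e₂, f₂⟩ := small v
    obtain ⟨D₃, hD₃, e₃, f₃⟩ := small w
    have hle : (m₁ + m₂ + m₃ + m₄ + m₅).real (D₁ ∪ D₂ ∪ D₃) ≤ ε :=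
      (measureReal_union_le _ _).trans (by
        linarith [measureReal_union_le (μ := m₁ + m₂ + m₃ + m₄ + m₅) D₁ D₂])
    have hsub : ∀ B : Set Ω, B ⊆ (D₁ ∪ D₂ ∪ D₃)ᶜ → B ⊆ D₁ᶜ ∧ B ⊆ D₂ᶜ ∧ B ⊆ D₃ᶜ := by
      intro B hB
      rw [Set.compl_union, Set.compl_union, Set.subset_inter_iff, Set.subset_inter_iff] at hB
      exact ⟨hB.1.1, hB.1.2, hB.2⟩
    refine ⟨D₁ ∪ D₂ ∪ D₃, (hD₁.union hD₂).union hD₃, ?_,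
      fun B hB hBC => (f₁ B hB (hsub B hBC).1).trans (by linarith),
      fun B hB hBC => (f₂ B hB (hsub B hBC).2.1).trans (by linarith),
      fun B hB hBC => (f₃ B hB (hsub B hBC).2.2).trans (by linarith)⟩
    rw [measureReal_add_apply, measureReal_add_apply, measureReal_add_apply,
      measureReal_add_apply] at hle
    have n₁ := measureReal_nonneg (μ := m₁) (s := D₁ ∪ D₂ ∪ D₃)
    have n₂ := measureReal_nonneg (μ := m₂) (s := D₁ ∪ D₂ ∪ D₃)
    have n₃ := measureReal_nonneg (μ := m₃) (s := D₁ ∪ D₂ ∪ D₃)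
    have n₄ := measureReal_nonneg (μ := m₄) (s := D₁ ∪ D₂ ∪ D₃)
    have n₅ := measureReal_nonneg (μ := m₅) (s := D₁ ∪ D₂ ∪ D₃)
    refine ⟨?_, ?_, ?_, ?_, ?_⟩ <;> linarith
  have hS₁ : MeasurableSet (S \ C) := hSm.diff hC
  have hS₂ : MeasurableSet (Sᶜ \ C) := hSm.compl.diff hC
  have hC₁ : S \ C ⊆ Cᶜ := fun _ h => h.2
  have hC₂ : Sᶜ \ C ⊆ Cᶜ := fun _ h => h.2
  -- Each near-maximizer is placed where its own functional is concentrated and the other two are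
  -- zero or small.
  let y : φ.space :=
    φ.mulIndicator u (S \ C) hS₁ + φ.mulIndicator v (Sᶜ \ C) hS₂ + φ.mulIndicator w C hC
  have hy : ∀ ℓ : φ.space →L[ℝ] ℝ, ℓ y = φ.setFunction ℓ u (S \ C) +
      φ.setFunction ℓ v (Sᶜ \ C) + φ.setFunction ℓ w C := fun ℓ => by
    rw [φ.setFunction_apply _ _ hS₁, φ.setFunction_apply _ _ hS₂, φ.setFunction_apply _ _ hC,
      ← map_add, ← map_add]
  -- The modular is at most 1 + 0 + ε: at most 1 from u, nothing from v off T, and at most `m₅ C`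
  -- from w.
  have hy_norm : ‖y‖ ≤ 1 + ε := by
    refine φ.norm_le_of_modular_le (by linarith) ?_
    refine (φ.modular_mulIndicator_add_add_le u v w hS₁ hS₂ hC ?_ ?_ ?_).trans ?_
    · exact disjoint_compl_right.mono Set.sdiff_subset Set.sdiff_subset
    · exact Set.disjoint_sdiff_left
    · exact Set.disjoint_sdiff_left
    rw [hT0 _ hS₂ (Set.sdiff_subset.trans (Set.compl_subset_compl.2 hTS)), add_zero,
      ENNReal.ofReal_add one_pos.le hε.le, ENNReal.ofReal_one]
    refine add_le_add (le_trans (exhaustingIntegral_mono (Eventually.of_forall fun ω => ?_))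
      (φ.modular_le_one_of_norm_lt_one hu)) ((hm₅ C hC).trans ?_)
    · exact Set.indicator_le_self _ _ ω
    · rw [← ofReal_measureReal (μ := m₅) (s := C)]
      exact ENNReal.ofReal_le_ofReal hCm.2.2.2.2
  -- the absolutely continuous part
  have a₁ : ℓa u - ε ≤ φ.setFunction ℓa u (S \ C) := by
    have e := (ba u).map_inter_add_sdiff .univ hSm
    rw [hSu0 _ (MeasurableSet.univ.diff hSm) fun ω hω h => hω.2 (hSuS h), φ.setFunction_univ,
      Set.univ_inter, ← (ba u).map_inter_add_sdiff hSm hC] at e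
    have := (abs_le.1 (hm₁ (S ∩ C) C (hSm.inter hC) Set.inter_subset_right)).2
    linarith [hCm.1]
  have a₂ : φ.setFunction ℓa v (Sᶜ \ C) = 0 := hSv0 _ hS₂ fun ω hω h => hω.1 (hSvS h)
  have a₃ := (abs_le.1 (hm₂ C C hC le_rfl)).1
  -- the diffuse part
  have d₁ : φ.setFunction ℓd u (S \ C) = 0 := (hd u).eq_zero_of_subset hS hS₁ Set.sdiff_subset
  have d₂ : ℓd v - ε ≤ φ.setFunction ℓd v (Sᶜ \ C) := by
    have e := (bd v).map_inter_add_sdiff .univ hSm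
    rw [φ.setFunction_univ, Set.univ_inter, (hd v).eq_zero_of_subset hS hSm le_rfl,
      ← Set.compl_eq_univ_sdiff, ← (bd v).map_inter_add_sdiff hSm.compl hC] at e
    have := (abs_le.1 (hm₃ (Sᶜ ∩ C) C (hSm.compl.inter hC) Set.inter_subset_right)).2
    linarith [hCm.2.2.1]
  have d₃ := (abs_le.1 (hm₄ C C hC le_rfl)).1
  -- the purely finitely additive part
  have f₁ := (abs_le.1 (hCu _ hS₁ hC₁)).1
  have f₂ := (abs_le.1 (hCv _ hS₂ hC₂)).1
  have f₃ : ℓf w - ε ≤ φ.setFunction ℓf w C := by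
    have e := (bf w).map_inter_add_sdiff .univ hC
    rw [φ.setFunction_univ, Set.univ_inter, ← Set.compl_eq_univ_sdiff] at e
    linarith [(abs_le.1 (hCw _ hC.compl le_rfl)).2]
  have hval : (ℓa + ℓd + ℓf) y ≤ ‖ℓa + ℓd + ℓf‖ * (1 + ε) :=
    (le_abs_self _).trans (((ℓa + ℓd + ℓf).le_opNorm y).trans
      (mul_le_mul_of_nonneg_left hy_norm (norm_nonneg _)))
  rw [add_apply, add_apply, hy ℓa, hy ℓd, hy ℓf] at hval
  linarith [hCm.2.1, hCm.2.2.2.1]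

end OrliczIntegrand

/-! ### The direct sum, uniqueness and the norm identity -/

theorem theorem6p5 {Ω : Type*} [MeasurableSpace Ω] (μ : Measure Ω)
    {X : Type*} [NormedAddCommGroup X] [NormedSpace ℝ X] [CompleteSpace X]
    [MeasurableSpace X] [BorelSpace X] (φ : OrliczIntegrand μ X) :
    -- the dual space is the direct sum of the three classes, which are linear subspaces
    (∃ A D F : Submodule ℝ (φ.space →L[ℝ] ℝ),
      (A : Set (φ.space →L[ℝ] ℝ)) = φ.acFunctionals ∧
      (D : Set (φ.space →L[ℝ] ℝ)) = φ.diffuseFunctionals ∧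
      (F : Set (φ.space →L[ℝ] ℝ)) = φ.pfaFunctionals ∧
      DirectSum.IsInternal ![A, D, F]) ∧
    -- existence and uniqueness of the decomposition
    (∀ ℓ : φ.space →L[ℝ] ℝ,
      ∃! p : (φ.space →L[ℝ] ℝ) × (φ.space →L[ℝ] ℝ) × (φ.space →L[ℝ] ℝ),
        p.1 ∈ φ.acFunctionals ∧ p.2.1 ∈ φ.diffuseFunctionals ∧ p.2.2 ∈ φ.pfaFunctionals ∧
        ℓ = p.1 + p.2.1 + p.2.2) ∧
    -- additivity of the dual (operator) norm
    (∀ ℓa ∈ φ.acFunctionals, ∀ ℓd ∈ φ.diffuseFunctionals, ∀ ℓf ∈ φ.pfaFunctionals,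
      ‖ℓa + ℓd + ℓf‖ = ‖ℓa‖ + ‖ℓd‖ + ‖ℓf‖) := by
  let A := φ.functionalsOf (IsAbsolutelyContinuousSetFunction.isRestrictionStable μ)
  let D := φ.functionalsOf (IsDiffuseSetFunction.isRestrictionStable μ)
  let F := φ.functionalsOf IsPurelyFinitelyAdditive.isRestrictionStable
  refine ⟨⟨A, D, F, rfl, rfl, rfl, ?_⟩, fun ℓ => ?_, fun ℓa ha ℓd hd ℓf hf => ?_⟩
  · exact isInternal_of_forall_exists_add_add A D F φ.exists_decomposition
      fun a ha d hd f hf h => φ.eq_zero_of_add_add_eq_zero ha hd hf h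
  · obtain ⟨ℓa, ha, ℓd, hd, ℓf, hf, rfl⟩ := φ.exists_decomposition ℓ
    refine ⟨(ℓa, ℓd, ℓf), ⟨ha, hd, hf, rfl⟩, ?_⟩
    rintro ⟨a, d, f⟩ ⟨ha', hd', hf', h⟩
    have h0 : (a - ℓa) + (d - ℓd) + (f - ℓf) = 0 := by
      have : ℓa + ℓd + ℓf = a + d + f := h
      rw [sub_add_sub_comm, sub_add_sub_comm, this, sub_self]
    obtain ⟨e₁, e₂, e₃⟩ := φ.eq_zero_of_add_add_eq_zero (A.sub_mem ha' ha) (D.sub_mem hd' hd)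
      (F.sub_mem hf' hf) h0
    exact Prod.ext (sub_eq_zero.1 e₁) (Prod.ext (sub_eq_zero.1 e₂) (sub_eq_zero.1 e₃))
  · exact le_antisymm ((norm_add_le _ _).trans (add_le_add_left (norm_add_le _ _) _))
      (φ.norm_add_add_le ha hd hf)
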